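/- Let $p,q\ge 0$ be integers and let $O(p,q)\subset GL(p+q,\mathbb{R})$ be the group of linear automorphisms of $\mathbb{R}^{p,q}$, that is, of $\mathbb{R}^{p+q}$ equipped with the standard symmetric bilinear form $\langle\cdot,\cdot\rangle$ with $p$ plus signs and $q$ minus signs, which preserve this form. Let $G\subset O(p,q)$ be a connected Lie subgroup, in the sense of an immersed (not necessarily embedded or closed) one, i.e. $G$ is the image of a connected Lie group under an injective immersive smooth homomorphism into $GL(p+q,\mathbb{R})$. Assume that $G$ acts irreducibly on $\mathbb{R}^{p+q}$ (so $p+q\ge 1$, and $0$ and $\mathbb{R}^{p+q}$ are the only $G$-invariant real subspaces). If $G$ is not semisimple, i.e. if its Lie algebra is not semisimple, then $p$ and $q$ are both even, and, up to an isometric identification, $G$ is a subgroup of $U(p/2,q/2)$ with center $U(1)$. Precisely: there is a real linear isomorphism $\varphi:\mathbb{C}^{p/2}\oplus\mathbb{C}^{q/2}\to\mathbb{R}^{p,q}$ with $\langle\varphi(z),\varphi(w)\rangle=\operatorname{Re}h(z,w)$ for all $z,w$, where $h(z,w)=\sum_{i=1}^{p/2}\overline{z_i}w_i-\sum_{j=1}^{q/2}\overline{z_{p/2+j}}\,w_{p/2+j}$,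 such that $G\subset\varphi\,U(p/2,q/2)\,\varphi^{-1}$, where $U(p/2,q/2)$ is the group of complex linear automorphisms that preserve $h$, and such that the center of $G$ is $\{\varphi\circ(c\,\mathrm{Id})\circ\varphi^{-1}\mid c\in\mathbb{C},\ |c|=1\}\cong U(1)$. -/

import Mathlib

open scoped Manifold ContDiff

noncomputable section

/-- The real vector space `ℝ^{p,q}`, of dimension `p + q`. -/
abbrev RSpace (p q : ℕ) : Type := Fin p ⊕ Fin q → ℝ

/-- The complex vector space `ℂ^{r,s}`, of dimension `r + s`. -/
abbrev CSpace (r s : ℕ) : Type := Fin r ⊕ Fin s → ℂ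

/-- The general linear group of `ℝ^{p,q}`, with its structure of a Lie group. -/
abbrev RGL (p q : ℕ) : Type := (RSpace p q →L[ℝ] RSpace p q)ˣ

/-- The standard symmetric bilinear form with `p` signs `+` and `q` signs `-`. -/
def pseudoInner (p q : ℕ) (x y : RSpace p q) : ℝ :=
  ∑ i, x (Sum.inl i) * y (Sum.inl i) - ∑ j, x (Sum.inr j) * y (Sum.inr j)

/-- The standard Hermitian form with `r` signs `+` and `s` signs `-`. -/
def pseudoHermitian (r s : ℕ) (z w : CSpace r s) : ℂ :=
  ∑ i, star (z (Sum.inl i)) * w (Sum.inl i) - ∑ j, star (z (Sum.inr j)) * w (Sum.inr j)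

/-- The pseudo-orthogonal group `O(p,q)`. -/
def pseudoOrthogonalGroup (p q : ℕ) : Subgroup (RGL p q) where
  carrier := {g | ∀ x y, pseudoInner p q (g.val x) (g.val y) = pseudoInner p q x y}
  one_mem' := fun _ _ => rfl
  mul_mem' := fun {a b} ha hb x y => (ha (b.val x) (b.val y)).trans (hb x y)
  inv_mem' := by
    intro a ha x y
    have h : ∀ v, a.val (a⁻¹.val v) = v := fun v => by
      rw [← mul_apply_eq_comp, Units.mul_inv, one_apply_eq_self]
    have h2 := ha (a⁻¹.val x) (a⁻¹.val y)
    rw [h, h] at h2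
    exact h2.symm

/-- The pseudo-unitary group `U(r,s)`. -/
def pseudoUnitaryGroup (r s : ℕ) : Subgroup (CSpace r s ≃ₗ[ℂ] CSpace r s) where
  carrier := {A | ∀ z w, pseudoHermitian r s (A z) (A w) = pseudoHermitian r s z w}
  one_mem' := fun _ _ => rfl
  mul_mem' := fun {a b} ha hb z w => (ha (b z) (b w)).trans (hb z w)
  inv_mem' := by
    intro a ha z w
    have h : ∀ v, a (a⁻¹ v) = v := fun v => a.apply_symm_apply v
    have h2 := ha (a⁻¹ z) (a⁻¹ w)
    rw [h, h] at h2
    exact h2.symm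

/-- The subgroup `U(1)` of `GL(ℂ^{r,s})`: multiplications by complex numbers of modulus one. -/
def scalarCircle (r s : ℕ) : Subgroup (CSpace r s ≃ₗ[ℂ] CSpace r s) :=
  (DistribMulAction.toModuleAut ℂ (CSpace r s) (S := Circle)).range

/-- A real linear isomorphism `φ : ℂ^{r,s} → ℝ^{p,q}` makes complex linear automorphisms of
`ℂ^{r,s}` into real linear automorphisms of `ℝ^{p,q}`, by `A ↦ φ ∘ A ∘ φ⁻¹`. -/
def realify {r s p q : ℕ} (φ : CSpace r s ≃ₗ[ℝ] RSpace p q) :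
    (CSpace r s ≃ₗ[ℂ] CSpace r s) →* RGL p q where
  toFun A := (ContinuousLinearEquiv.unitsEquiv ℝ (RSpace p q)).symm
    ((φ.symm.trans (A.restrictScalars ℝ)).trans φ).toContinuousLinearEquiv
  map_one' := by
    ext1
    ext1 x
    exact φ.apply_symm_apply x
  map_mul' A B := by
    ext1
    ext1 x
    change φ (A (B (φ.symm x))) = φ (A (φ.symm (φ (B (φ.symm x)))))
    rw [φ.symm_apply_apply]

/-- The tautological representation on `ℝ^{p,q}` of a subgroup of its general linear group. -/
def tautologicalRep {p q : ℕ} (G : Subgroup (RGL p q)) : Representation ℝ G (RSpace p q) where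
  toFun g := ((g : RGL p q).val : RSpace p q →ₗ[ℝ] RSpace p q)
  map_one' := rfl
  map_mul' _ _ := rfl

/-- The smooth homomorphism `ι` from a Lie group `H` makes the subgroup `G` of `GL(ℝ^{p,q})` an
immersed, not necessarily embedded, Lie subgroup: `ι` is an injective immersion with image `G`. -/
structure IsImmersedLieSubgroup {p q : ℕ} (d : ℕ) (G : Subgroup (RGL p q))
    {H : Type*} [Group H] [TopologicalSpace H] [ChartedSpace (EuclideanSpace ℝ (Fin d)) H]
    (ι : H →* RGL p q) : Prop where
  contMDiff : ContMDiff (𝓡 d) 𝓘(ℝ, RSpace p q →L[ℝ] RSpace p q) ∞ ι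
  injective_mfderiv : ∀ h : H,
    Function.Injective (mfderiv (𝓡 d) 𝓘(ℝ, RSpace p q →L[ℝ] RSpace p q) ι h)
  injective : Function.Injective ι
  range_eq : ι.range = G

/-- A smooth real Lie group is smooth enough for its Lie algebra to be defined. -/
instance lieGroup_minSmoothness {d : ℕ} {H : Type*} [Group H] [TopologicalSpace H]
    [ChartedSpace (EuclideanSpace ℝ (Fin d)) H] [LieGroup (𝓡 d) ∞ H] :
    LieGroup (𝓡 d) (minSmoothness ℝ 3) H := by
  rw [minSmoothness_of_isRCLikeNormedField]
  infer_instance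

end

/-! The Lie algebra of `G` acts faithfully and irreducibly on `ℝ^{p,q}`: by connectedness `G` lies
in the associative algebra generated by its Lie algebra (`mem_adjoin_range_tangentMapOne`), so both
have the same invariant subspaces. An abelian ideal of such a Lie algebra is central
(`le_center_of_isLieAbelian_of_isIrreducible`). Hence, if the Lie algebra is not semisimple, its
center contains some `X ≠ 0`.

The operator `X` commutes with `G`, and its one-parameter group lies in `G`
(`exp_smul_tangentMapOne_mem_range`), so `X` is skew for the form. By Schur's lemma the commutant of
`G` is a real algebra of finite dimension without zero divisors, in which every element is quadratic
over `ℝ`. A nonzero skew element then has a negative scalar as its square, and a multiple `J` of `X`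
satisfies `J² = -1` (`IsIrreducibleSet.exists_mul_self_eq_neg_one`).

The form is the real part of a Hermitian form for `J`. A unitary basis gives `φ`
(`exists_linearEquiv_of_complexStructure`), and comparing signatures gives `p = 2r`, `q = 2s`. The
elements of `G` commute with `J`, hence are unitary. A central element of `G` lies in the commutant
and commutes with `J`, so it is `a + bJ`, and orthogonality forces `a² + b² = 1`. Conversely, these
operators are the `exp (θJ)`, which lie in `G`. -/

open Polynomial in
/-- In characteristic zero, an endomorphism all of whose positive powers have trace zero is
nilpotent. -/
theorem isNilpotent_of_forall_trace_pow_succ_eq_zero {K V : Type*} [Field K] [CharZero K]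
    [AddCommGroup V] [Module K V] [FiniteDimensional K V] {f : Module.End K V}
    (h : ∀ k : ℕ, LinearMap.trace K V (f ^ (k + 1)) = 0) : IsNilpotent f := by
  have htr : ∀ r : K[X], LinearMap.trace K V (aeval f (r * X)) = 0 := by
    intro r
    induction r using Polynomial.induction_on' with
    | add p q hp hq => rw [add_mul, map_add, map_add, hp, hq, add_zero]
    | monomial n a =>
      rw [← C_mul_X_pow_eq_monomial, mul_assoc, ← pow_succ, map_mul, aeval_C, map_pow, aeval_X,
        ← Algebra.smul_def, map_smul, h, smul_zero]
  have hne : minpoly K f ≠ 0 := minpoly.ne_zero (Algebra.IsIntegral.isIntegral f)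
  obtain ⟨q, hq, hdvd⟩ := exists_eq_pow_rootMultiplicity_mul_and_not_dvd _ hne 0
  rw [C_0, sub_zero] at hq hdvd
  set n := rootMultiplicity 0 (minpoly K f)
  have hcop : IsCoprime (X ^ (n + 1) : K[X]) q :=
    ((prime_X.irreducible.coprime_iff_not_dvd).2 hdvd).pow_left
  obtain ⟨a, b, hab⟩ := hcop
  -- `e` is the Fitting projection onto the part where `f` is invertible. It is a polynomial in `f`
  -- without constant term, so its trace vanishes; in characteristic zero an idempotent of trace
  -- zero is zero.
  set e := aeval f (a * X ^ (n + 1)) with he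
  have h1 : e + aeval f (b * q) = 1 := by rw [he, ← map_add, hab, map_one]
  have h0 : aeval f (X ^ n * q) = 0 := by rw [← hq, minpoly.aeval]
  have h2 : e * aeval f (b * q) = 0 := by
    rw [he, ← map_mul, show a * X ^ (n + 1) * (b * q) = (a * b * X) * (X ^ n * q) by ring, map_mul,
      h0, mul_zero]
  have hidem : IsIdempotentElem e := by
    have := congrArg (e * ·) h1
    simp only [mul_add, h2, add_zero, mul_one] at this
    exact this
  have he0 : e = 0 := by
    refine LinearMap.IsIdempotentElem.eq_zero_of_trace_eq_zero hidem ?_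
    rw [he, pow_succ, ← mul_assoc]
    exact htr _
  rw [he0, zero_add] at h1
  refine ⟨n, ?_⟩
  calc f ^ n = f ^ n * aeval f (b * q) := by rw [h1, mul_one]
    _ = aeval f (b * (X ^ n * q)) := by
      rw [show b * (X ^ n * q) = X ^ n * (b * q) by ring, map_mul (aeval f) (X ^ n), map_pow,
        aeval_X]
    _ = 0 := by rw [map_mul, h0, mul_zero]

/-! ### Abelian ideals and faithful irreducible representations. -/

section Reductive

attribute [local instance] LieRing.ofAssociativeRing

open LieAlgebra LieModule

/-- If `c` commutes with the ideal `I`, then it is orthogonal to `⁅L, I⁆` for the trace form. -/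
theorem trace_mul_toEnd_eq_zero_of_mem_lie {K L M : Type*} [Field K] [LieRing L] [LieAlgebra K L]
    [AddCommGroup M] [Module K M] [LieRingModule L M] [LieModule K L M] (I : LieIdeal K L) (c : Module.End K M)
    (hc : ∀ a ∈ I, Commute c (toEnd K L M a)) {x : L} (hx : x ∈ ⁅(⊤ : LieIdeal K L), I⁆) :
    LinearMap.trace K M (c * toEnd K L M x) = 0 := by
  rw [← LieSubmodule.mem_toSubmodule, LieSubmodule.lieIdeal_oper_eq_linear_span'] at hx
  induction hx using Submodule.span_induction with
  | mem x hx =>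
    obtain ⟨y, -, a, ha, rfl⟩ := hx
    -- `tr (c y a) = tr (a c y) = tr (c a y)`.
    rw [LieHom.map_lie, Ring.lie_def, mul_sub, map_sub, sub_eq_zero, ← mul_assoc, ← mul_assoc,
      LinearMap.trace_mul_comm, ← mul_assoc, (hc a ha).eq]
  | zero => simp
  | add x y _ _ hx hy => rw [map_add, mul_add, map_add, hx, hy, add_zero]
  | smul t x _ hx => rw [map_smul, mul_smul_comm, map_smul, hx, smul_zero]

variable {K L M : Type*} [Field K] [CharZero K] [LieRing L] [LieAlgebra K L]
  [FiniteDimensional K L] [AddCommGroup M] [Module K M] [FiniteDimensional K M]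
  [LieRingModule L M] [LieModule K L M]

/-- An abelian ideal of a Lie algebra with a faithful irreducible representation is central. -/
theorem le_center_of_isLieAbelian_of_isIrreducible [IsIrreducible K L M] [IsFaithful K L M]
    (I : LieIdeal K L) [IsLieAbelian I] : I ≤ center K L := by
  let J : LieIdeal K L := ⁅(⊤ : LieIdeal K L), I⁆
  have hJI : J ≤ I := LieSubmodule.lie_le_right I ⊤
  have hcomm : ∀ a ∈ I, ∀ b ∈ I, Commute (toEnd K L M a) (toEnd K L M b) := by
    intro a ha b hb
    have h : ⁅(⟨a, ha⟩ : I), (⟨b, hb⟩ : I)⁆ = 0 := trivial_lie_zero _ _ _ _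
    have h' : ⁅a, b⁆ = 0 := congrArg Subtype.val h
    rw [commute_iff_lie_eq, ← LieHom.map_lie, h', map_zero]
  -- Since `x ∈ J ≤ I` and `I` is abelian, each power `x ^ k` commutes with `I`, so `tr (x ^ k * x)
  -- = 0`.
  have hnil : ∀ x : J, IsNilpotent (toEnd K J M x) := by
    intro x
    refine isNilpotent_of_forall_trace_pow_succ_eq_zero fun k => ?_
    rw [pow_succ]
    exact trace_mul_toEnd_eq_zero_of_mem_lie I (toEnd K L M (x : L) ^ k)
      (fun a ha => (hcomm _ (hJI x.2) a ha).pow_left k) x.2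
  have hN : LieModule.IsNilpotent J M := (LieModule.isNilpotent_iff_forall (R := K)).2 hnil
  have := nontrivial_of_isIrreducible K L M
  have hT := nontrivial_max_triv_of_isNilpotent K J M
  -- By Engel's theorem `J` kills a nonzero vector. The vectors killed by `J` are stable under `L`
  -- because `J` is an ideal, so by irreducibility `J` kills all of `M`.
  let N : LieSubmodule K L M :=
    { (maxTrivSubmodule K J M : Submodule K M) with
      lie_mem := by
        intro y m hm
        rw [AddSubsemigroup.mem_carrier, AddSubmonoid.mem_toSubsemigroup, Submodule.mem_toAddSubmonoid,
          LieSubmodule.mem_toSubmodule, mem_maxTrivSubmodule] at hm ⊢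
        intro x
        have h1 : ⁅(x : L), m⁆ = 0 := hm x
        have h2 : ⁅⁅(x : L), y⁆, m⁆ = 0 := hm ⟨⁅(x : L), y⁆, lie_mem_left K L J x y x.2⟩
        change ⁅(x : L), ⁅y, m⁆⁆ = 0
        rw [leibniz_lie, h1, h2, lie_zero, add_zero] }
  have hNtop : N = ⊤ := by
    have : Nontrivial N := hT
    exact N.eq_top_of_isIrreducible K L M
  have hJ : ∀ x ∈ J, x = 0 := by
    intro x hx
    rw [← toEnd_eq_zero_iff (R := K) (L := L) (M := M)]
    ext m
    have hm : m ∈ N := hNtop ▸ LieSubmodule.mem_top m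
    exact (mem_maxTrivSubmodule K J M m).1 hm ⟨x, hx⟩
  intro a ha
  rw [mem_maxTrivSubmodule]
  exact fun y => hJ _ (LieSubmodule.lie_mem_lie (LieSubmodule.mem_top y) ha)

/-- A Lie algebra with a faithful irreducible representation is semisimple if its center is
trivial. -/
theorem exists_mem_center_ne_zero_of_not_isSemisimple [IsIrreducible K L M] [IsFaithful K L M]
    (h : ¬ IsSemisimple K L) : ∃ x ∈ center K L, x ≠ 0 := by
  by_contra! hc
  refine h ?_
  have : HasTrivialRadical K L := (hasTrivialRadical_iff_no_abelian_ideals K L).2 fun I hI =>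
    (LieSubmodule.eq_bot_iff I).2 fun x hx =>
      hc x (le_center_of_isLieAbelian_of_isIrreducible (M := M) I hx)
  infer_instance

end Reductive

/-! ### Lie brackets of vector fields and commutators in an algebra. -/

section VectorFieldsInAlgebra

variable {E A : Type*} [NormedAddCommGroup E] [NormedSpace ℝ E] [NormedRing A] [NormedAlgebra ℝ A]

/-- If `f` maps two vector fields to right multiplication by `a` and by `b`, it maps their Lie
bracket to right multiplication by the commutator of `a` and `b`. -/
theorem fderiv_lieBracket_of_eventuallyEq_mul {f : E → A} {V W : E → E} {a b : A} {x : E}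
    (hf : ContDiffAt ℝ 2 f x) (hV : DifferentiableAt ℝ V x) (hW : DifferentiableAt ℝ W x)
    (hfV : ∀ᶠ y in nhds x, fderiv ℝ f y (V y) = f y * a)
    (hfW : ∀ᶠ y in nhds x, fderiv ℝ f y (W y) = f y * b) :
    fderiv ℝ f x (VectorField.lieBracket ℝ V W x) = f x * (a * b - b * a) := by
  have hf1 : DifferentiableAt ℝ f x := hf.differentiableAt (by norm_num)
  have hf2 : DifferentiableAt ℝ (fderiv ℝ f) x :=
    (hf.fderiv_right (m := 1) (by norm_num)).differentiableAt (by norm_num)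
  -- Differentiate `Df(U) = f c` in the direction `u`. For `(U, u) = (V, W)` and `(W, V)` the second
  -- derivatives of `f` agree by symmetry and cancel in the bracket.
  have key : ∀ {U : E → E} {c : A}, DifferentiableAt ℝ U x →
      (∀ᶠ y in nhds x, fderiv ℝ f y (U y) = f y * c) → ∀ u : E,
      fderiv ℝ f x (fderiv ℝ U x u) + fderiv ℝ (fderiv ℝ f) x u (U x) = fderiv ℝ f x u * c := by
    intro U c hU hfU u
    have h1 := (hf2.hasFDerivAt.clm_apply hU.hasFDerivAt).unique
      ((hf1.hasFDerivAt.mul_const' c).congr_of_eventuallyEq hfU)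
    have h2 := DFunLike.congr_fun h1 u
    simpa using h2
  have hsymm : fderiv ℝ (fderiv ℝ f) x (V x) (W x) = fderiv ℝ (fderiv ℝ f) x (W x) (V x) :=
    (hf.isSymmSndFDerivAt (by simp)) (V x) (W x)
  have h1 := key hV hfV (W x)
  have h2 := key hW hfW (V x)
  rw [hfW.self_of_nhds, mul_assoc] at h1
  rw [hfV.self_of_nhds, mul_assoc] at h2
  rw [VectorField.lieBracket_eq, map_sub, mul_sub, ← h1, ← h2, hsymm]
  abel

end VectorFieldsInAlgebra

/-! ### Left-invariant fields under a homomorphism to an algebra. -/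

section LieGroupHom

open VectorField

variable {E A H : Type*} [NormedAddCommGroup E] [NormedSpace ℝ E]
  [NormedRing A] [NormedAlgebra ℝ A] [Group H] [TopologicalSpace H] [ChartedSpace E H]

/-- The differential at the identity of a map from a Lie group to a normed algebra. -/
noncomputable def tangentMapOne (F : H → A) : GroupLieAlgebra 𝓘(ℝ, E) H →ₗ[ℝ] A :=
  (mfderiv 𝓘(ℝ, E) 𝓘(ℝ, A) F 1).toLinearMap

variable [LieGroup 𝓘(ℝ, E) (minSmoothness ℝ 3) H] {F : H →* A}

theorem minSmoothness_three_ne_zero : minSmoothness ℝ 3 ≠ 0 :=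
  (lt_of_lt_of_le (by simp) le_minSmoothness).ne'

theorem mdifferentiableAt_mul_left_lieGroup (g h : H) :
    MDifferentiableAt 𝓘(ℝ, E) 𝓘(ℝ, E) (fun x : H => g * x) h :=
  (contMDiff_mul_left (I := 𝓘(ℝ, E)) (n := minSmoothness ℝ 3)).contMDiffAt.mdifferentiableAt
    minSmoothness_three_ne_zero

/-- This is the derivative of `F (h * x) = F h * F x` at `x = 1`. -/
theorem mfderiv_mulInvariantVectorField (hF : ContMDiff 𝓘(ℝ, E) 𝓘(ℝ, A) ∞ F)
    (v : GroupLieAlgebra 𝓘(ℝ, E) H) (h : H) :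
    mfderiv 𝓘(ℝ, E) 𝓘(ℝ, A) F h (mulInvariantVectorField v h) = F h * tangentMapOne F v := by
  have hd : ∀ g, MDifferentiableAt 𝓘(ℝ, E) 𝓘(ℝ, A) F g := fun g =>
    (hF g).mdifferentiableAt (by simp)
  have h1 : HasMFDerivAt 𝓘(ℝ, E) 𝓘(ℝ, A) (F ∘ fun x => h * x) (1 : H)
      ((mfderiv 𝓘(ℝ, E) 𝓘(ℝ, A) F (h * 1)).comp
        (mfderiv 𝓘(ℝ, E) 𝓘(ℝ, E) (fun x : H => h * x) 1)) :=
    (hd (h * 1)).hasMFDerivAt.comp (1 : H) (mdifferentiableAt_mul_left_lieGroup h 1).hasMFDerivAt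
  have h2 : HasMFDerivAt 𝓘(ℝ, E) 𝓘(ℝ, A) ((ContinuousLinearMap.mul ℝ A (F h)) ∘ F) (1 : H)
      ((ContinuousLinearMap.mul ℝ A (F h)).comp (mfderiv 𝓘(ℝ, E) 𝓘(ℝ, A) F 1)) :=
    (ContinuousLinearMap.mul ℝ A (F h)).hasMFDerivAt.comp (1 : H) (hd 1).hasMFDerivAt
  have h3 : (F ∘ fun x => h * x) = (ContinuousLinearMap.mul ℝ A (F h)) ∘ F := by
    ext x; simp
  rw [h3] at h1
  have h4 := DFunLike.congr_fun (hasMFDerivAt_unique h1 h2) v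
  rw [mul_one] at h4
  exact h4

/-- Translating `w` back to the identity by `h⁻¹` shows that it is the value at `h` of a
left-invariant field. -/
theorem mfderiv_eq_mul_tangentMapOne (hF : ContMDiff 𝓘(ℝ, E) 𝓘(ℝ, A) ∞ F)
    (h : H) (w : TangentSpace 𝓘(ℝ, E) h) :
    ∃ v : GroupLieAlgebra 𝓘(ℝ, E) H, mfderiv 𝓘(ℝ, E) 𝓘(ℝ, A) F h w = F h * tangentMapOne F v := by
  have h1 : mfderiv 𝓘(ℝ, E) 𝓘(ℝ, E) (fun x : H => h * x) 1 ∘L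
      mfderiv 𝓘(ℝ, E) 𝓘(ℝ, E) (fun x : H => h⁻¹ * x) h = ContinuousLinearMap.id ℝ _ := by
    have h2 : (fun x : H => h * x) ∘ (fun x : H => h⁻¹ * x) = id := by ext x; simp
    have h3 := mfderiv_comp h (mdifferentiableAt_mul_left_lieGroup (E := E) h (h⁻¹ * h))
      (mdifferentiableAt_mul_left_lieGroup (E := E) h⁻¹ h)
    rw [h2, mfderiv_id, inv_mul_cancel] at h3
    exact h3.symm
  let v : GroupLieAlgebra 𝓘(ℝ, E) H :=
    (mfderiv 𝓘(ℝ, E) 𝓘(ℝ, E) (fun x : H => h⁻¹ * x) h w : E)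
  have hv : mulInvariantVectorField v h = w := DFunLike.congr_fun h1 w
  exact ⟨v, by rw [← mfderiv_mulInvariantVectorField hF, hv]⟩

end LieGroupHom

/-! ### The differential at the identity respects brackets. -/

section LieGroupHomInCharts

open VectorField Set

variable {E A H : Type*} [NormedAddCommGroup E] [NormedSpace ℝ E]
  [NormedRing A] [NormedAlgebra ℝ A] [Group H] [TopologicalSpace H] [ChartedSpace E H]
  [LieGroup 𝓘(ℝ, E) (minSmoothness ℝ 3) H] {F : H →* A}

theorem contDiffOn_comp_extChartAt_symm (hF : ContMDiff 𝓘(ℝ, E) 𝓘(ℝ, A) ∞ F) (x : H) :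
    ContDiffOn ℝ 2 (F ∘ (extChartAt 𝓘(ℝ, E) x).symm) (extChartAt 𝓘(ℝ, E) x).target := by
  have : IsManifold 𝓘(ℝ, E) 2 H := IsManifold.of_le (n := minSmoothness ℝ 3)
    (by rw [minSmoothness_of_isRCLikeNormedField]; norm_num)
  rw [← contMDiffOn_iff_contDiffOn]
  exact (hF.of_le ENat.LEInfty.out).comp_contMDiffOn (contMDiffOn_extChartAt_symm x)

theorem contDiffAt_comp_extChartAt_symm (hF : ContMDiff 𝓘(ℝ, E) 𝓘(ℝ, A) ∞ F) (x : H) {y : E}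
    (hy : y ∈ (extChartAt 𝓘(ℝ, E) x).target) :
    ContDiffAt ℝ 2 (F ∘ (extChartAt 𝓘(ℝ, E) x).symm) y :=
  (contDiffOn_comp_extChartAt_symm hF x).contDiffAt ((isOpen_extChartAt_target x).mem_nhds hy)

theorem fderiv_comp_extChartAt_symm (hF : ContMDiff 𝓘(ℝ, E) 𝓘(ℝ, A) ∞ F) (x : H) {y : E}
    (hy : y ∈ (extChartAt 𝓘(ℝ, E) x).target) (u : E) :
    fderiv ℝ (F ∘ (extChartAt 𝓘(ℝ, E) x).symm) y u =
      mfderiv 𝓘(ℝ, E) 𝓘(ℝ, A) F ((extChartAt 𝓘(ℝ, E) x).symm y)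
        (mfderivWithin 𝓘(ℝ, E) 𝓘(ℝ, E) (extChartAt 𝓘(ℝ, E) x).symm (range 𝓘(ℝ, E)) y u) := by
  have : IsManifold 𝓘(ℝ, E) 1 H := IsManifold.of_le (n := minSmoothness ℝ 3)
    (by rw [minSmoothness_of_isRCLikeNormedField]; norm_num)
  have h1 := ((hF ((extChartAt 𝓘(ℝ, E) x).symm y)).mdifferentiableAt (by simp)).hasMFDerivAt
  have h2 := (mdifferentiableWithinAt_extChartAt_symm hy).hasMFDerivWithinAt
  have h3 := h1.comp_hasMFDerivWithinAt y h2
  let D₁ : E →L[ℝ] A := mfderiv 𝓘(ℝ, E) 𝓘(ℝ, A) F ((extChartAt 𝓘(ℝ, E) x).symm y)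
  let D₂ : E →L[ℝ] E :=
    mfderivWithin 𝓘(ℝ, E) 𝓘(ℝ, E) (extChartAt 𝓘(ℝ, E) x).symm (range 𝓘(ℝ, E)) y
  have h4 : HasFDerivAt (F ∘ (extChartAt 𝓘(ℝ, E) x).symm) (D₁.comp D₂) y := by
    rw [ModelWithCorners.range_eq_univ, hasMFDerivWithinAt_univ] at h3
    simp only [D₂, ModelWithCorners.range_eq_univ]
    exact hasMFDerivAt_iff_hasFDerivAt.1 h3
  rw [h4.fderiv]
  rfl

theorem fderiv_comp_extChartAt_symm_self (hF : ContMDiff 𝓘(ℝ, E) 𝓘(ℝ, A) ∞ F) (x : H) (u : E) :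
    fderiv ℝ (F ∘ (extChartAt 𝓘(ℝ, E) x).symm) (extChartAt 𝓘(ℝ, E) x x) u =
      mfderiv 𝓘(ℝ, E) 𝓘(ℝ, A) F x u := by
  have : IsManifold 𝓘(ℝ, E) 1 H := IsManifold.of_le (n := minSmoothness ℝ 3)
    (by rw [minSmoothness_of_isRCLikeNormedField]; norm_num)
  have h1 := mfderivWithin_extChartAt_symm_comp_mfderiv_extChartAt' (I := 𝓘(ℝ, E))
    (mem_extChartAt_source (I := 𝓘(ℝ, E)) x)
  rw [mfderiv_extChartAt_self] at h1
  rw [fderiv_comp_extChartAt_symm hF x (mem_extChartAt_target x)]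
  have h2 := DFunLike.congr_fun h1 u
  have h3 : mfderivWithin 𝓘(ℝ, E) 𝓘(ℝ, E) (extChartAt 𝓘(ℝ, E) x).symm (range 𝓘(ℝ, E))
    (extChartAt 𝓘(ℝ, E) x x) u = u := h2
  rw [h3, extChartAt_to_inv]

/-- Read in a chart, left-invariant fields thus satisfy the hypothesis of
`fderiv_lieBracket_of_eventuallyEq_mul`. -/
theorem eventually_fderiv_mpullbackWithin_mulInvariantVectorField
    (hF : ContMDiff 𝓘(ℝ, E) 𝓘(ℝ, A) ∞ F) (x : H) (v : GroupLieAlgebra 𝓘(ℝ, E) H) :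
    ∀ᶠ y in nhds (extChartAt 𝓘(ℝ, E) x x),
      fderiv ℝ (F ∘ (extChartAt 𝓘(ℝ, E) x).symm) y
        (mpullbackWithin 𝓘(ℝ, E) 𝓘(ℝ, E) (extChartAt 𝓘(ℝ, E) x).symm
          (mulInvariantVectorField v) (range 𝓘(ℝ, E)) y) =
      (F ∘ (extChartAt 𝓘(ℝ, E) x).symm) y * tangentMapOne F v := by
  have : IsManifold 𝓘(ℝ, E) 1 H := IsManifold.of_le (n := minSmoothness ℝ 3)
    (by rw [minSmoothness_of_isRCLikeNormedField]; norm_num)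
  filter_upwards [extChartAt_target_mem_nhds (I := 𝓘(ℝ, E)) x] with y hy
  refine (fderiv_comp_extChartAt_symm hF x hy _).trans ?_
  have h1 := (isInvertible_mfderivWithin_extChartAt_symm hy).self_comp_inverse
  have h2 := DFunLike.congr_fun h1 (mulInvariantVectorField v ((extChartAt 𝓘(ℝ, E) x).symm y))
  refine Eq.trans (congrArg _ h2) ?_
  exact mfderiv_mulInvariantVectorField hF v _

theorem differentiableAt_mpullbackWithin_mulInvariantVectorField [CompleteSpace E] (x : H)
    (v : GroupLieAlgebra 𝓘(ℝ, E) H) :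
    DifferentiableAt ℝ (mpullbackWithin 𝓘(ℝ, E) 𝓘(ℝ, E) (extChartAt 𝓘(ℝ, E) x).symm
      (mulInvariantVectorField v) (range 𝓘(ℝ, E))) (extChartAt 𝓘(ℝ, E) x x) := by
  have h2 : IsManifold 𝓘(ℝ, E) (1 + 1) H := IsManifold.of_le (n := minSmoothness ℝ 3)
    (by rw [minSmoothness_of_isRCLikeNormedField]; norm_num)
  have : IsManifold 𝓘(ℝ, E) 2 H := by rwa [one_add_one_eq_two] at h2
  have hv : ContMDiffAt 𝓘(ℝ, E) 𝓘(ℝ, E).tangent 1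
      (fun g : H => (mulInvariantVectorField v g : TangentBundle 𝓘(ℝ, E) H)) x :=
    (contMDiffAt_mulInvariantVectorField v).of_le
      (by rw [minSmoothness_of_isRCLikeNormedField]; norm_num)
  have h := contMDiffWithinAt_mpullbackWithin_extChartAt_symm (n := 2) (m := 1)
    (contMDiffWithinAt_univ.2 hv) uniqueMDiffOn_univ (mem_univ x) (by norm_num)
  rw [preimage_univ, inter_univ] at h
  have h' := h.contMDiffAt (extChartAt_target_mem_nhds (I := 𝓘(ℝ, E)) x)
  exact (contMDiffAt_vectorSpace_iff_contDiffAt.1 h').differentiableAt (by norm_num)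

/-- The differential of a homomorphism from a Lie group to the units of a normed algebra maps the
Lie bracket to the commutator. -/
theorem tangentMapOne_lie [CompleteSpace E] (hF : ContMDiff 𝓘(ℝ, E) 𝓘(ℝ, A) ∞ F)
    (v w : GroupLieAlgebra 𝓘(ℝ, E) H) :
    tangentMapOne F ⁅v, w⁆ =
      tangentMapOne F v * tangentMapOne F w - tangentMapOne F w * tangentMapOne F v := by
  have : IsManifold 𝓘(ℝ, E) 1 H := IsManifold.of_le (n := minSmoothness ℝ 3)
    (by rw [minSmoothness_of_isRCLikeNormedField]; norm_num)
  have h := fderiv_lieBracket_of_eventuallyEq_mul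
    (contDiffAt_comp_extChartAt_symm hF 1 (mem_extChartAt_target 1))
    (differentiableAt_mpullbackWithin_mulInvariantVectorField 1 v)
    (differentiableAt_mpullbackWithin_mulInvariantVectorField 1 w)
    (eventually_fderiv_mpullbackWithin_mulInvariantVectorField hF 1 v)
    (eventually_fderiv_mpullbackWithin_mulInvariantVectorField hF 1 w)
  rw [fderiv_comp_extChartAt_symm_self hF, Function.comp_apply, extChartAt_to_inv, map_one,
    one_mul] at h
  -- The bracket on `H` is computed in the chart at `1`, whose derivative at its own base point is
  -- the identity.
  have hinv : ∀ u : E, (mfderiv 𝓘(ℝ, E) 𝓘(ℝ, E) (extChartAt 𝓘(ℝ, E) (1 : H)) 1).inverse u = u := by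
    intro u
    rw [mfderiv_extChartAt_self]
    exact DFunLike.congr_fun (ContinuousLinearMap.inverse_id (R := ℝ) (M := E)) u
  rw [← h]
  refine congrArg (mfderiv 𝓘(ℝ, E) 𝓘(ℝ, A) F 1) ?_
  rw [GroupLieAlgebra.bracket_def, ← mlieBracketWithin_univ, mlieBracketWithin_apply]
  refine (hinv _).trans ?_
  rw [preimage_univ, univ_inter]
  have hrange : ∀ (V W : E → E) (y : E),
      lieBracketWithin ℝ V W (range 𝓘(ℝ, E)) y = lieBracket ℝ V W y := by
    intro V W y
    rw [ModelWithCorners.range_eq_univ, lieBracketWithin_univ]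
  exact hrange _ _ _

end LieGroupHomInCharts

/-! ### From the Lie algebra to the connected group, and exponentials. -/

section ConnectedLieGroupHom

open VectorField Set

variable {E A H : Type*} [NormedAddCommGroup E] [NormedSpace ℝ E]
  [NormedRing A] [NormedAlgebra ℝ A] [Group H] [TopologicalSpace H] [ChartedSpace E H]
  [LieGroup 𝓘(ℝ, E) (minSmoothness ℝ 3) H] {F : H →* A}

/-- A solution of the linear equation `X' = X θ` stays in a subspace which is invariant under right
multiplication by all the values of `θ`. -/
theorem mem_of_hasDerivWithinAt_mul [FiniteDimensional ℝ A] (S : Submodule ℝ A) {X θ : ℝ → A}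
    {C : ℝ} (hX : ∀ t ∈ Icc (0 : ℝ) 1, HasDerivAt X (X t * θ t) t)
    (hθ : ∀ t ∈ Icc (0 : ℝ) 1, ‖θ t‖ ≤ C) (hS : ∀ t ∈ Icc (0 : ℝ) 1, ∀ s ∈ S, s * θ t ∈ S)
    (h0 : X 0 ∈ S) : X 1 ∈ S := by
  obtain ⟨S', hS'⟩ := S.exists_isCompl
  -- `P` is a projection with kernel `S`. Invariance of `S` gives `P (X θ) = P (P X θ)`, so `P X`
  -- satisfies a linear differential inequality with zero initial value and vanishes by Grönwall.
  let P : A →L[ℝ] A := LinearMap.toContinuousLinearMap (S'.projection S hS'.symm)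
  have hP : ∀ x, P x = 0 ↔ x ∈ S := fun x => Submodule.projection_apply_eq_zero_iff hS'.symm
  have hPP : ∀ x, x - P x ∈ S := by
    intro x
    rw [← hP, map_sub, sub_eq_zero]
    exact (Submodule.projection_apply_left hS'.symm ⟨P x, Submodule.projection_apply_mem _ _⟩).symm
  have hPmul : ∀ t ∈ Icc (0 : ℝ) 1, P (X t * θ t) = P (P (X t) * θ t) := by
    intro t ht
    rw [← sub_eq_zero, ← map_sub, ← sub_mul, hP]
    exact hS t ht _ (hPP _)
  have hd : ∀ t ∈ Icc (0 : ℝ) 1, HasDerivAt (fun t => P (X t)) (P (X t * θ t)) t :=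
    fun t ht => P.hasFDerivAt.comp_hasDerivAt t (hX t ht)
  have := eq_zero_of_abs_deriv_le_mul_abs_self_of_eq_zero_right (f := fun t => P (X t))
    (f' := fun t => P (X t * θ t)) (K := ‖P‖ * C) (a := 0) (b := 1)
    (fun t ht => (hd t ht).continuousAt.continuousWithinAt)
    (fun t ht => (hd t (Ico_subset_Icc_self ht)).hasDerivWithinAt) ((hP _).2 h0) (by
      intro t ht
      have ht' := Ico_subset_Icc_self ht
      rw [hPmul t ht']
      calc ‖P (P (X t) * θ t)‖ ≤ ‖P‖ * (‖P (X t)‖ * ‖θ t‖) :=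
            (P.le_opNorm _).trans (mul_le_mul_of_nonneg_left (norm_mul_le _ _) (norm_nonneg _))
        _ ≤ ‖P‖ * (‖P (X t)‖ * C) := by gcongr; exact hθ t ht'
        _ = ‖P‖ * C * ‖P (X t)‖ := by ring) 1 (right_mem_Icc.2 zero_le_one)
  exact (hP _).1 this

/-- Near a point of a Lie group, a homomorphism stays in a subspace which is invariant under right
multiplication by the image of the Lie algebra. -/
theorem eventually_mem_of_mul_tangentMapOne_mem [FiniteDimensional ℝ A]
    (hF : ContMDiff 𝓘(ℝ, E) 𝓘(ℝ, A) ∞ F) (S : Submodule ℝ A)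
    (hS : ∀ s ∈ S, ∀ v : GroupLieAlgebra 𝓘(ℝ, E) H, s * tangentMapOne F v ∈ S) (h₀ : H) :
    ∀ᶠ h in nhds h₀, F h₀ ∈ S ↔ F h ∈ S := by
  set φ := extChartAt 𝓘(ℝ, E) h₀
  obtain ⟨ε, hε, hball⟩ := Metric.isOpen_iff.1 (isOpen_extChartAt_target (I := 𝓘(ℝ, E)) h₀) (φ h₀)
    (mem_extChartAt_target h₀)
  have key : ∀ y ∈ Metric.ball (φ h₀) ε, ∀ z ∈ Metric.ball (φ h₀) ε,
      F (φ.symm y) ∈ S → F (φ.symm z) ∈ S := by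
    intro y hy z hz hyS
    let c : ℝ → E := fun t => y + t • (z - y)
    have hc : ∀ t ∈ Icc (0 : ℝ) 1, c t ∈ φ.target := fun t ht =>
      hball ((convex_ball _ _).add_smul_sub_mem hy hz ht)
    have hcd : ∀ t, HasDerivAt c (z - y) t := fun t => by
      simpa [c] using ((hasDerivAt_id t).smul_const (z - y)).const_add y
    have hcc : ContinuousOn c (Icc 0 1) := fun t _ => (hcd t).continuousAt.continuousWithinAt
    let f : E → A := F ∘ φ.symm
    have hf : ContDiffOn ℝ 2 f φ.target := contDiffOn_comp_extChartAt_symm hF h₀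
    -- Logarithmic derivative of `F` along the segment from `y` to `z` in the chart; the inverse is
    -- taken in `H`. Its values lie in the image of the Lie algebra.
    let θ : ℝ → A := fun t => F (φ.symm (c t))⁻¹ * fderiv ℝ f (c t) (z - y)
    have hinv : ∀ h : H, F h * F h⁻¹ = 1 := fun h => by rw [← map_mul, mul_inv_cancel, map_one]
    have hinv' : ∀ h : H, F h⁻¹ * F h = 1 := fun h => by rw [← map_mul, inv_mul_cancel, map_one]
    have hX : ∀ t ∈ Icc (0 : ℝ) 1, HasDerivAt (f ∘ c) ((f ∘ c) t * θ t) t := by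
      intro t ht
      have h1 : DifferentiableAt ℝ f (c t) :=
        (contDiffAt_comp_extChartAt_symm hF h₀ (hc t ht)).differentiableAt (by norm_num)
      have h2 := h1.hasFDerivAt.comp_hasDerivAt t (hcd t)
      have h3 : (f ∘ c) t * θ t = fderiv ℝ f (c t) (z - y) := by
        simp only [θ, f, Function.comp_apply, ← mul_assoc]
        rw [hinv, one_mul]
      rwa [h3]
    have hθc : ContinuousOn θ (Icc 0 1) := by
      have hgroup : IsTopologicalGroup H :=
        topologicalGroup_of_lieGroup 𝓘(ℝ, E) (minSmoothness ℝ 3)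
      refine ContinuousOn.mul ?_ ?_
      · exact hF.continuous.comp_continuousOn
          (((continuousOn_extChartAt_symm h₀).comp hcc hc).inv)
      · exact ((hf.continuousOn_fderiv_of_isOpen (isOpen_extChartAt_target h₀)
          (by norm_num)).comp hcc hc).clm_apply continuousOn_const
    obtain ⟨C, hC⟩ := isCompact_Icc.exists_bound_of_continuousOn hθc
    have hθ : ∀ t ∈ Icc (0 : ℝ) 1, ∃ v : GroupLieAlgebra 𝓘(ℝ, E) H, θ t = tangentMapOne F v := by
      intro t ht
      obtain ⟨v, hv⟩ := mfderiv_eq_mul_tangentMapOne hF (φ.symm (c t))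
        (mfderivWithin 𝓘(ℝ, E) 𝓘(ℝ, E) φ.symm (range 𝓘(ℝ, E)) (c t) (z - y))
      refine ⟨v, ?_⟩
      have h1 : fderiv ℝ f (c t) (z - y) = F (φ.symm (c t)) * tangentMapOne F v :=
        (fderiv_comp_extChartAt_symm hF h₀ (hc t ht) _).trans hv
      simp only [θ]
      rw [h1, ← mul_assoc, hinv', one_mul]
    have h0 : (f ∘ c) 0 ∈ S := by simpa [f, c] using hyS
    have h1 := mem_of_hasDerivWithinAt_mul S hX hC (fun t ht s hs => by
      obtain ⟨v, hv⟩ := hθ t ht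
      rw [hv]
      exact hS s hs v) h0
    simpa [f, c] using h1
  have hnhds : ∀ᶠ h in nhds h₀, φ h ∈ Metric.ball (φ h₀) ε :=
    (continuousAt_extChartAt h₀).eventually (Metric.ball_mem_nhds _ hε)
  filter_upwards [hnhds, extChartAt_source_mem_nhds (I := 𝓘(ℝ, E)) h₀] with h hh hs
  have h1 : φ.symm (φ h) = h := φ.left_inv hs
  have h2 : φ.symm (φ h₀) = h₀ := extChartAt_to_inv h₀
  have hz := Metric.mem_ball_self (x := φ h₀) hε
  constructor
  · intro h3
    simpa [h1] using key _ hz _ hh (by rwa [h2])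
  · intro h3
    simpa [h2] using key _ hh _ hz (by rwa [h1])

/-- The local statement is an equivalence, so the set of `h` with `F h ∈ S` is both open and closed;
it contains `1`. -/
theorem mem_of_mul_tangentMapOne_mem [FiniteDimensional ℝ A] [ConnectedSpace H]
    (hF : ContMDiff 𝓘(ℝ, E) 𝓘(ℝ, A) ∞ F) (S : Submodule ℝ A)
    (hS : ∀ s ∈ S, ∀ v : GroupLieAlgebra 𝓘(ℝ, E) H, s * tangentMapOne F v ∈ S)
    (h1 : (1 : A) ∈ S) (h : H) : F h ∈ S := by
  have hloc := eventually_mem_of_mul_tangentMapOne_mem hF S hS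
  have hclopen : IsClopen {h : H | F h ∈ S} := by
    constructor
    · rw [← isOpen_compl_iff, isOpen_iff_mem_nhds]
      intro g hg
      filter_upwards [hloc g] with k hk using fun hk' => hg (hk.2 hk')
    · rw [isOpen_iff_mem_nhds]
      intro g hg
      filter_upwards [hloc g] with k hk using hk.1 hg
  have huniv := hclopen.eq_univ ⟨1, by simpa using h1⟩
  exact huniv.ge (mem_univ h)

/-- A homomorphism from a connected Lie group takes values in the algebra generated by the image of
the Lie algebra. -/
theorem mem_adjoin_range_tangentMapOne [FiniteDimensional ℝ A] [ConnectedSpace H]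
    (hF : ContMDiff 𝓘(ℝ, E) 𝓘(ℝ, A) ∞ F) (h : H) :
    F h ∈ Algebra.adjoin ℝ
      (range (tangentMapOne F : GroupLieAlgebra 𝓘(ℝ, E) H → A)) :=
  mem_of_mul_tangentMapOne_mem hF (Subalgebra.toSubmodule (Algebra.adjoin ℝ
      (range (tangentMapOne F : GroupLieAlgebra 𝓘(ℝ, E) H → A))))
    (fun _ hs v => Subalgebra.mul_mem _ hs (Algebra.subset_adjoin ⟨v, rfl⟩))
    (Subalgebra.one_mem _) h

open NormedSpace in
-- Along a local integral curve `γ` of the left-invariant field, `F ∘ γ` solves `Y' = Y a`. Hence `F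
-- (γ t) * exp (-t a)` is constant, equal to `1`.
theorem eventually_exp_smul_tangentMapOne_mem_range [CompleteSpace E] [CompleteSpace A]
    (hF : ContMDiff 𝓘(ℝ, E) 𝓘(ℝ, A) ∞ F) (v : GroupLieAlgebra 𝓘(ℝ, E) H) :
    ∀ᶠ t : ℝ in nhds 0, exp (t • tangentMapOne F v) ∈ range F := by
  have : IsManifold 𝓘(ℝ, E) 1 H := IsManifold.of_le (n := minSmoothness ℝ 3)
    (by rw [minSmoothness_of_isRCLikeNormedField]; norm_num)
  set a : A := tangentMapOne F v
  have hv : ContMDiffAt 𝓘(ℝ, E) 𝓘(ℝ, E).tangent 1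
      (fun g : H => (mulInvariantVectorField v g : TangentBundle 𝓘(ℝ, E) H)) 1 :=
    (contMDiffAt_mulInvariantVectorField v).of_le
      (by rw [minSmoothness_of_isRCLikeNormedField]; norm_num)
  obtain ⟨γ, hγ0, hγ⟩ := exists_isMIntegralCurveAt_of_contMDiffAt_boundaryless (t₀ := 0) hv
  have hd : ∀ᶠ t : ℝ in nhds 0, HasDerivAt (F ∘ γ) (F (γ t) * a) t := by
    filter_upwards [hγ] with t ht
    have h1 := ((hF (γ t)).mdifferentiableAt (by simp)).hasMFDerivAt.comp t ht
    let D : E →L[ℝ] A := mfderiv 𝓘(ℝ, E) 𝓘(ℝ, A) F (γ t)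
    let u : E := mulInvariantVectorField v (γ t)
    have h2 : HasFDerivAt (F ∘ γ) (D.comp ((1 : ℝ →L[ℝ] ℝ).smulRight u)) t :=
      hasMFDerivAt_iff_hasFDerivAt.1 h1
    have h3 : D u = F (γ t) * a := mfderiv_mulInvariantVectorField hF v (γ t)
    simpa [h3] using h2.hasDerivAt
  obtain ⟨ε, hε, hball⟩ := Metric.eventually_nhds_iff_ball.1 hd
  have hexp : ∀ t : ℝ, HasDerivAt (fun s : ℝ => exp (s • -a)) (-a * exp (t • -a)) t :=
    fun t => hasDerivAt_exp_smul_const' (-a) t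
  have hY : ∀ t ∈ Metric.ball (0 : ℝ) ε, HasDerivAt (fun t => F (γ t) * exp (t • -a)) 0 t := by
    intro t ht
    have h1 := (hball t ht).mul (hexp t)
    rwa [Function.comp_apply, neg_mul, mul_neg, mul_assoc, add_neg_cancel] at h1
  filter_upwards [Metric.ball_mem_nhds (0 : ℝ) hε] with t ht
  have hconst := Metric.isOpen_ball.is_const_of_deriv_eq_zero
    (convex_ball (0 : ℝ) ε).isPreconnected
    (fun s hs => (hY s hs).differentiableAt.differentiableWithinAt)
    (fun s hs => (hY s hs).deriv) ht (Metric.mem_ball_self hε)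
  simp only [hγ0, map_one, zero_smul, exp_zero, mul_one] at hconst
  refine ⟨γ t, ?_⟩
  have h1 : exp (t • -a) * exp (t • a) = 1 := by
    let _ : NormedAlgebra ℚ A := NormedAlgebra.restrictScalars ℚ ℝ A
    have := exp_add_of_commute (x := t • -a) (y := t • a)
      (((Commute.refl a).neg_left.smul_left t).smul_right t)
    rw [← this]; simp
  rw [← mul_one (F (γ t)), ← h1, ← mul_assoc, hconst, one_mul]

open NormedSpace in
/-- The one-parameter groups generated by the image of the Lie algebra are contained in the image of
the Lie group. -/
theorem exp_smul_tangentMapOne_mem_range [CompleteSpace E] [CompleteSpace A]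
    (hF : ContMDiff 𝓘(ℝ, E) 𝓘(ℝ, A) ∞ F) (v : GroupLieAlgebra 𝓘(ℝ, E) H) (t : ℝ) :
    exp (t • tangentMapOne F v) ∈ range F := by
  let _ : NormedAlgebra ℚ A := NormedAlgebra.restrictScalars ℚ ℝ A
  -- The local result reaches every `t` because `exp (t a)` is the `(n + 1)`-st power of `exp (t /
  -- (n + 1) a)`.
  have hlim : Filter.Tendsto (fun n : ℕ => t / ((n : ℝ) + 1)) Filter.atTop (nhds 0) := by
    simpa [div_eq_mul_inv] using tendsto_one_div_add_atTop_nhds_zero_nat.const_mul t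
  obtain ⟨n, h, hn⟩ := (hlim.eventually (eventually_exp_smul_tangentMapOne_mem_range hF v)).exists
  refine ⟨h ^ (n + 1), ?_⟩
  rw [map_pow, hn, ← exp_nsmul, ← Nat.cast_smul_eq_nsmul ℝ, smul_smul]
  congr 2
  push_cast
  field_simp

end ConnectedLieGroupHom

/-! ### Quadratic elements in real division algebras. -/

section RealDivisionAlgebra

open Polynomial

variable {D : Type*} [Ring D] [IsDomain D] [Algebra ℝ D] [Algebra.IsIntegral ℝ D]

/-- Every element of a real division algebra of finite dimension is the sum of a scalar and an
element whose square is a scalar. -/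
theorem exists_sub_algebraMap_mul_self_eq_algebraMap (T : D) :
    ∃ a δ : ℝ, (T - algebraMap ℝ D a) * (T - algebraMap ℝ D a) = algebraMap ℝ D δ := by
  have hint : IsIntegral ℝ T := Algebra.IsIntegral.isIntegral T
  have hdeg : (minpoly ℝ T).natDegree ≤ 2 := (minpoly.irreducible hint).natDegree_le_two
  have hpos : 0 < (minpoly ℝ T).natDegree := minpoly.natDegree_pos hint
  have hmonic := minpoly.monic hint
  have haeval := minpoly.aeval ℝ T
  rw [aeval_eq_sum_range] at haeval
  have hlead := hmonic.coeff_natDegree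
  obtain h | h : (minpoly ℝ T).natDegree = 1 ∨ (minpoly ℝ T).natDegree = 2 := by omega
  · rw [h] at haeval hlead
    simp only [Finset.sum_range_succ, Finset.sum_range_zero, hlead, pow_zero, pow_one, one_smul,
      zero_add] at haeval
    refine ⟨-(minpoly ℝ T).coeff 0, 0, ?_⟩
    have : T - algebraMap ℝ D (-(minpoly ℝ T).coeff 0) = 0 := by
      rw [← haeval, map_neg, sub_neg_eq_add, Algebra.algebraMap_eq_smul_one, add_comm]
    rw [this, mul_zero, map_zero]
  · rw [h] at haeval hlead
    simp only [Finset.sum_range_succ, Finset.sum_range_zero, hlead, pow_zero, pow_one, one_smul,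
      zero_add] at haeval
    set s := (minpoly ℝ T).coeff 1
    set t := (minpoly ℝ T).coeff 0
    -- Completing the square in `T² + sT + t = 0`.
    refine ⟨-(s / 2), s ^ 2 / 4 - t, ?_⟩
    rw [Algebra.algebraMap_eq_smul_one, Algebra.algebraMap_eq_smul_one, ← sub_eq_zero, ← haeval]
    simp only [sub_mul, mul_sub, smul_mul_assoc, mul_smul_comm, one_mul, mul_one, pow_two]
    module

/-- In a real division algebra of finite dimension, the centralizer of an imaginary unit `J` is
spanned by `1` and `J`. -/
theorem exists_eq_smul_one_add_smul_of_commute {J T : D} (hJ : J * J = -1) (hTJ : Commute T J) :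
    ∃ a b : ℝ, T = a • (1 : D) + b • J := by
  obtain ⟨a, δ, h⟩ := exists_sub_algebraMap_mul_self_eq_algebraMap T
  -- Either way `(T - a)²` is the square of an element commuting with `T - a`: the scalar `√δ`, or
  -- `√(-δ) J`. Without zero divisors, `T - a` equals it up to sign.
  obtain hδ | hδ := le_total 0 δ
  · have h1 : (T - algebraMap ℝ D a) * (T - algebraMap ℝ D a) =
        algebraMap ℝ D (√δ) * algebraMap ℝ D (√δ) := by
      rw [h, ← map_mul, Real.mul_self_sqrt hδ]
    rcases (Algebra.commute_algebraMap_right (√δ) (T - algebraMap ℝ D a)).mul_self_eq_mul_self_iff.1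
      h1 with h2 | h2
    · refine ⟨a + √δ, 0, ?_⟩
      rw [sub_eq_iff_eq_add] at h2
      rw [h2, zero_smul, add_zero, add_smul, Algebra.algebraMap_eq_smul_one,
        Algebra.algebraMap_eq_smul_one, add_comm]
    · refine ⟨a - √δ, 0, ?_⟩
      rw [sub_eq_iff_eq_add] at h2
      rw [h2, zero_smul, add_zero, sub_smul, Algebra.algebraMap_eq_smul_one,
        Algebra.algebraMap_eq_smul_one, sub_eq_neg_add]
  · have h1 : (T - algebraMap ℝ D a) * (T - algebraMap ℝ D a) = (√(-δ) • J) * (√(-δ) • J) := by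
      rw [h, smul_mul_smul_comm, Real.mul_self_sqrt (neg_nonneg.2 hδ), hJ, smul_neg, neg_smul,
        neg_neg, Algebra.algebraMap_eq_smul_one]
    have hc : Commute (T - algebraMap ℝ D a) (√(-δ) • J) :=
      (hTJ.sub_left (Algebra.commutes a J)).smul_right _
    rcases hc.mul_self_eq_mul_self_iff.1 h1 with h2 | h2
    · refine ⟨a, √(-δ), ?_⟩
      rw [sub_eq_iff_eq_add] at h2
      rw [h2, Algebra.algebraMap_eq_smul_one, add_comm]
    · refine ⟨a, -√(-δ), ?_⟩
      rw [sub_eq_iff_eq_add] at h2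
      rw [h2, Algebra.algebraMap_eq_smul_one, neg_smul, add_comm]

end RealDivisionAlgebra

/-! ### Schur's lemma and skew operators in the commutant. -/

section Schur

variable {V : Type*} [NormedAddCommGroup V] [NormedSpace ℝ V]

/-- A set of operators is irreducible if it has no proper nontrivial invariant subspace. -/
def IsIrreducibleSet (Γ : Set (V →L[ℝ] V)) : Prop :=
  ∀ W : Submodule ℝ V, (∀ g ∈ Γ, ∀ x ∈ W, g x ∈ W) → W = ⊥ ∨ W = ⊤

/-- **Schur's lemma**: the centralizer of an irreducible set of operators has no zero divisors. -/
theorem IsIrreducibleSet.isDomain_centralizer [Nontrivial V] {Γ : Set (V →L[ℝ] V)}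
    (h : IsIrreducibleSet Γ) : IsDomain (Subalgebra.centralizer ℝ Γ) := by
  have : NoZeroDivisors (Subalgebra.centralizer ℝ Γ) := by
    refine ⟨fun {S T} hST => ?_⟩
    -- The kernel of `S` is invariant, so `S` is injective or zero.
    have hker : ∀ g ∈ Γ, ∀ x ∈ LinearMap.ker (S : V →L[ℝ] V).toLinearMap,
        g x ∈ LinearMap.ker (S : V →L[ℝ] V).toLinearMap := by
      intro g hg x hx
      have hx' : (S : V →L[ℝ] V) x = 0 := hx
      have h1 : (S : V →L[ℝ] V) (g x) = g ((S : V →L[ℝ] V) x) :=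
        (DFunLike.congr_fun ((Subalgebra.mem_centralizer_iff ℝ).1 S.2 g hg) x).symm
      change (S : V →L[ℝ] V) (g x) = 0
      rw [h1, hx', map_zero]
    rcases h _ hker with h0 | h0
    · right
      ext x
      have h1 : (T : V →L[ℝ] V) x ∈ LinearMap.ker (S : V →L[ℝ] V).toLinearMap :=
        DFunLike.congr_fun (congrArg Subtype.val hST) x
      rw [h0] at h1
      exact h1
    · left
      ext x
      have h1 : x ∈ LinearMap.ker (S : V →L[ℝ] V).toLinearMap := h0 ▸ Submodule.mem_top
      exact h1
  exact NoZeroDivisors.to_isDomain _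

/-- An operator which commutes with an irreducible set of operators and is skew-symmetric for a
nondegenerate bilinear form is a multiple of a complex structure. -/
theorem IsIrreducibleSet.exists_mul_self_eq_neg_one [Nontrivial V] [FiniteDimensional ℝ V]
    {Γ : Set (V →L[ℝ] V)} (h : IsIrreducibleSet Γ) {B : LinearMap.BilinForm ℝ V}
    (hB : B.Nondegenerate) {X : V →L[ℝ] V} (hX : X ∈ Subalgebra.centralizer ℝ Γ) (hX0 : X ≠ 0)
    (hskew : ∀ x y, B (X x) y = -B x (X y)) :
    ∃ c : ℝ, 0 < c ∧ (c • X) * (c • X) = -1 := by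
  have := h.isDomain_centralizer
  set D := Subalgebra.centralizer ℝ Γ
  have hBinj : ∀ x, (∀ y, B x y = 0) → x = 0 := hB.1
  obtain ⟨a, δ, hquad⟩ := exists_sub_algebraMap_mul_self_eq_algebraMap (⟨X, hX⟩ : D)
  have hquad' : ∀ x, X (X x) = (2 * a) • X x + (δ - a * a) • x := by
    intro x
    have h1 := DFunLike.congr_fun (congrArg Subtype.val hquad) x
    have h2 : X (X x - a • x) - a • (X x - a • x) = δ • x := h1
    rw [map_sub, map_smul] at h2
    calc X (X x) = (X (X x) - a • X x - a • (X x - a • x)) + ((2 * a) • X x - (a * a) • x) := by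
          module
      _ = _ := by rw [h2]; module
  -- `X²` is symmetric for `B`, hence so is `2aX`; but `X` is skew and nonzero.
  have ha : a = 0 := by
    by_contra ha
    refine hX0 (ContinuousLinearMap.ext fun x => hBinj _ fun y => ?_)
    have h1 : B (X (X x)) y = B x (X (X y)) := by rw [hskew, hskew, neg_neg]
    rw [hquad', hquad'] at h1
    simp only [map_add, map_smul, LinearMap.add_apply, LinearMap.smul_apply, smul_eq_mul] at h1
    have h2 := hskew x y
    have h3 : a * B (X x) y = 0 := by linear_combination h1 / 4 + a * h2 / 2
    exact (mul_eq_zero.1 h3).resolve_left ha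
  subst ha
  rw [map_zero, sub_zero] at hquad
  -- If `δ ≥ 0`, then `X = ±√δ` is a scalar, and a skew scalar is zero.
  have hδ : δ < 0 := by
    by_contra! hδ
    have h1 : (⟨X, hX⟩ : D) * ⟨X, hX⟩ = algebraMap ℝ D (√δ) * algebraMap ℝ D (√δ) := by
      rw [hquad, ← map_mul, Real.mul_self_sqrt hδ]
    obtain ⟨r, hr⟩ : ∃ r : ℝ, ∀ x, X x = r • x := by
      rcases (Algebra.commute_algebraMap_right (√δ) (⟨X, hX⟩ : D)).mul_self_eq_mul_self_iff.1
        h1 with h2 | h2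
      · exact ⟨√δ, fun x => DFunLike.congr_fun (congrArg Subtype.val h2) x⟩
      · refine ⟨-√δ, fun x => ?_⟩
        rw [neg_smul]
        exact DFunLike.congr_fun (congrArg Subtype.val h2) x
    refine hX0 (ContinuousLinearMap.ext fun x => hBinj _ fun y => ?_)
    have h2 := hskew x y
    simp only [hr, map_smul, LinearMap.smul_apply, smul_eq_mul] at h2 ⊢
    linarith
  have hpos : 0 < -δ := neg_pos.2 hδ
  refine ⟨(√(-δ))⁻¹, by positivity, ?_⟩
  ext x
  have h1 : X (X x) = δ • x := DFunLike.congr_fun (congrArg Subtype.val hquad) x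
  change (√(-δ))⁻¹ • X ((√(-δ))⁻¹ • X x) = -x
  rw [map_smul, h1, smul_smul, smul_smul, ← mul_inv, Real.mul_self_sqrt hpos.le, inv_neg, neg_mul,
    inv_mul_cancel₀ hδ.ne, neg_smul, one_smul]

end Schur

/-! ### Unitary bases for indefinite Hermitian forms. -/

section HermitianNormalForm

open Complex

variable {V ι : Type*} [AddCommGroup V] [Module ℝ V]

/-- The family `e` is a unitary family with signs `ε`, for the Hermitian form with real part `B`
on `V` with the complex structure `J`. -/
structure IsPseudoUnitaryFamily [DecidableEq ι] (B : LinearMap.BilinForm ℝ V) (J : V →ₗ[ℝ] V)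
    (e : ι → V) (ε : ι → ℝ) : Prop where
  sign : ∀ i, ε i = 1 ∨ ε i = -1
  apply_apply : ∀ i j, B (e i) (e j) = if i = j then ε i else 0
  apply_complexStructure : ∀ i j, B (e i) (J (e j)) = 0

theorem IsPseudoUnitaryFamily.sign_mul_self [DecidableEq ι] {B : LinearMap.BilinForm ℝ V}
    {J : V →ₗ[ℝ] V} {e : ι → V} {ε : ι → ℝ} (he : IsPseudoUnitaryFamily B J e ε) (i : ι) :
    ε i * ε i = 1 := by
  rcases he.sign i with h | h <;> simp [h]

variable [Fintype ι]

/-- The real linear map from `ℂ^ι` to `V` which maps the standard basis to `e`, and which is complex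
linear for the complex structure `J`. -/
def complexCombination (J : V →ₗ[ℝ] V) (e : ι → V) : (ι → ℂ) →ₗ[ℝ] V where
  toFun z := ∑ i, ((z i).re • e i + (z i).im • J (e i))
  map_add' z w := by
    rw [← Finset.sum_add_distrib]
    refine Finset.sum_congr rfl fun i _ => ?_
    simp only [Pi.add_apply, add_re, add_im]
    module
  map_smul' a z := by
    rw [RingHom.id_apply, Finset.smul_sum]
    refine Finset.sum_congr rfl fun i _ => ?_
    simp only [Pi.smul_apply, smul_re, smul_im, smul_eq_mul]
    module

theorem complexCombination_apply (J : V →ₗ[ℝ] V) (e : ι → V) (z : ι → ℂ) :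
    complexCombination J e z = ∑ i, ((z i).re • e i + (z i).im • J (e i)) := rfl

theorem complexCombination_I_smul {J : V →ₗ[ℝ] V} (hJ : ∀ x, J (J x) = -x) (e : ι → V)
    (z : ι → ℂ) : complexCombination J e (I • z) = J (complexCombination J e z) := by
  rw [complexCombination_apply, complexCombination_apply, map_sum]
  refine Finset.sum_congr rfl fun i _ => ?_
  simp only [Pi.smul_apply, smul_eq_mul, I_mul_re, I_mul_im, map_add, map_smul, hJ]
  module

namespace IsPseudoUnitaryFamily

variable [DecidableEq ι] {B : LinearMap.BilinForm ℝ V} {J : V →ₗ[ℝ] V} {e : ι → V} {ε : ι → ℝ}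

theorem apply_complexCombination (he : IsPseudoUnitaryFamily B J e ε) (i : ι) (z : ι → ℂ) :
    B (e i) (complexCombination J e z) = ε i * (z i).re := by
  rw [complexCombination_apply, map_sum]
  simp only [map_add, map_smul, he.apply_apply, he.apply_complexStructure, smul_eq_mul, mul_zero,
    add_zero, mul_ite]
  rw [Finset.sum_ite_eq Finset.univ i, if_pos (Finset.mem_univ i), mul_comm]

theorem complexStructure_apply_complexCombination (he : IsPseudoUnitaryFamily B J e ε)
    (hJ : ∀ x, J (J x) = -x) (hskew : ∀ x y, B (J x) y = -B x (J y)) (i : ι) (z : ι → ℂ) :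
    B (J (e i)) (complexCombination J e z) = ε i * (z i).im := by
  rw [hskew, ← complexCombination_I_smul hJ, he.apply_complexCombination]
  simp

theorem complexCombination_apply_apply (he : IsPseudoUnitaryFamily B J e ε)
    (hJ : ∀ x, J (J x) = -x) (hskew : ∀ x y, B (J x) y = -B x (J y)) (z w : ι → ℂ) :
    B (complexCombination J e z) (complexCombination J e w) =
      ∑ i, ε i * (star (z i) * w i).re := by
  rw [complexCombination_apply J e z, map_sum, LinearMap.sum_apply]
  refine Finset.sum_congr rfl fun i _ => ?_
  rw [map_add, map_smul, map_smul, LinearMap.add_apply, LinearMap.smul_apply, LinearMap.smul_apply,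
    he.apply_complexCombination, he.complexStructure_apply_complexCombination hJ hskew]
  simp only [smul_eq_mul, mul_re, star_def, conj_re, conj_im]
  ring

theorem complexCombination_injective (he : IsPseudoUnitaryFamily B J e ε)
    (hJ : ∀ x, J (J x) = -x) (hskew : ∀ x y, B (J x) y = -B x (J y)) :
    Function.Injective (complexCombination J e) := by
  rw [injective_iff_map_eq_zero]
  intro z hz
  have hε : ∀ i, ε i ≠ 0 := fun i h => by simpa [h] using he.sign_mul_self i
  ext i
  apply Complex.ext
  · have h := he.apply_complexCombination i z
    rw [hz, map_zero] at h
    exact (mul_eq_zero.1 h.symm).resolve_left (hε i)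
  · have h := he.complexStructure_apply_complexCombination hJ hskew i z
    rw [hz, map_zero] at h
    exact (mul_eq_zero.1 h.symm).resolve_left (hε i)

/-- Every vector is the sum of a combination of a unitary family and of a vector which is orthogonal
to this family. -/
theorem exists_sub_complexCombination_orthogonal (he : IsPseudoUnitaryFamily B J e ε)
    (hJ : ∀ x, J (J x) = -x) (hskew : ∀ x y, B (J x) y = -B x (J y)) (x : V) :
    ∃ z, ∀ i, B (e i) (x - complexCombination J e z) = 0 ∧
      B (J (e i)) (x - complexCombination J e z) = 0 := by
  refine ⟨fun i => ⟨ε i * B (e i) x, ε i * B (J (e i)) x⟩, fun i => ?_⟩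
  rw [map_sub, map_sub, he.apply_complexCombination,
    he.complexStructure_apply_complexCombination hJ hskew, ← mul_assoc, ← mul_assoc,
    he.sign_mul_self, one_mul, one_mul, sub_self, sub_self]
  exact ⟨rfl, rfl⟩

theorem exists_orthogonal_of_not_surjective (he : IsPseudoUnitaryFamily B J e ε)
    (hsymm : ∀ x y, B x y = B y x) (hB : ∀ x, (∀ y, B x y = 0) → x = 0)
    (hJ : ∀ x, J (J x) = -x) (hskew : ∀ x y, B (J x) y = -B x (J y))
    (hsurj : ¬ Function.Surjective (complexCombination J e)) :
    ∃ v, (B v v = 1 ∨ B v v = -1) ∧ ∀ i, B (e i) v = 0 ∧ B (J (e i)) v = 0 := by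
  -- If all vectors orthogonal to the family were isotropic, polarization would make `B` vanish on
  -- the orthogonal complement. Any vector there would be orthogonal to everything, hence zero, and
  -- the family would span.
  obtain ⟨v, hv, hvo⟩ : ∃ v, B v v ≠ 0 ∧ ∀ i, B (e i) v = 0 ∧ B (J (e i)) v = 0 := by
    by_contra! hcon
    have hiso : ∀ v, (∀ i, B (e i) v = 0 ∧ B (J (e i)) v = 0) → B v v = 0 := by
      intro v hv
      by_contra hne
      obtain ⟨i, hi⟩ := hcon v hne
      exact hi (hv i).1 (hv i).2
    refine hsurj fun x => ?_
    obtain ⟨z, hz⟩ := he.exists_sub_complexCombination_orthogonal hJ hskew x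
    refine ⟨z, (sub_eq_zero.1 (hB _ fun u => ?_)).symm⟩
    obtain ⟨w, hw⟩ := he.exists_sub_complexCombination_orthogonal hJ hskew u
    set y := x - complexCombination J e z
    set u' := u - complexCombination J e w
    have h1 : B y (complexCombination J e w) = 0 := by
      rw [hsymm, complexCombination_apply, map_sum, LinearMap.sum_apply]
      refine Finset.sum_eq_zero fun i _ => ?_
      simp [(hz i).1, (hz i).2]
    have h2 : B (y + u') (y + u') = 0 := hiso _ fun i => by
      simp [(hz i).1, (hz i).2, (hw i).1, (hw i).2]
    rw [map_add, map_add, LinearMap.add_apply, LinearMap.add_apply, hiso y hz, hiso u' hw,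
      hsymm u' y] at h2
    have h3 : u = u' + complexCombination J e w := (sub_add_cancel _ _).symm
    rw [h3, map_add, h1]
    linarith
  have hpos : 0 < |B v v| := abs_pos.2 hv
  refine ⟨(√|B v v|)⁻¹ • v, ?_, fun i => by simp [(hvo i).1, (hvo i).2]⟩
  have h1 : B ((√|B v v|)⁻¹ • v) ((√|B v v|)⁻¹ • v) = |B v v|⁻¹ * B v v := by
    rw [map_smul, map_smul, LinearMap.smul_apply, smul_eq_mul, smul_eq_mul, ← mul_assoc, ← mul_inv,
      Real.mul_self_sqrt hpos.le]
  rw [h1]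
  rcases abs_choice (B v v) with h | h <;> rw [h]
  · exact Or.inl (inv_mul_cancel₀ hv)
  · exact Or.inr (by rw [inv_neg, neg_mul, inv_mul_cancel₀ hv])

theorem cons {k : ℕ} {e : Fin k → V} {ε : Fin k → ℝ} (he : IsPseudoUnitaryFamily B J e ε)
    (hsymm : ∀ x y, B x y = B y x) (hskew : ∀ x y, B (J x) y = -B x (J y)) {v : V}
    (hv : B v v = 1 ∨ B v v = -1) (hvo : ∀ i, B (e i) v = 0 ∧ B (J (e i)) v = 0) :
    IsPseudoUnitaryFamily B J (Fin.cons v e : Fin (k + 1) → V)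
      (Fin.cons (B v v) ε : Fin (k + 1) → ℝ) where
  sign i := by
    induction i using Fin.cases with
    | zero => exact hv
    | succ i => exact he.sign i
  apply_apply i j := by
    induction i using Fin.cases with
    | zero =>
      induction j using Fin.cases with
      | zero => simp
      | succ j => simp [hsymm v, (hvo j).1, (Fin.succ_ne_zero j).symm]
    | succ i =>
      induction j using Fin.cases with
      | zero => simp [(hvo i).1]
      | succ j => simp [he.apply_apply]
  apply_complexStructure i j := by
    induction i using Fin.cases with
    | zero =>
      induction j using Fin.cases with
      | zero =>
        have h := hskew v v
        rw [hsymm] at h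
        simp only [Fin.cons_zero]
        linarith
      | succ j => simp [hsymm v, (hvo j).2]
    | succ i =>
      induction j using Fin.cases with
      | zero =>
        have h := hskew (e i) v
        rw [(hvo i).2] at h
        simpa using h.symm
      | succ j => simp [he.apply_complexStructure]

end IsPseudoUnitaryFamily

/-- A nondegenerate Hermitian form on a complex vector space of finite dimension has a unitary
basis. -/
theorem exists_isPseudoUnitaryFamily_surjective [FiniteDimensional ℝ V]
    {B : LinearMap.BilinForm ℝ V} {J : V →ₗ[ℝ] V}
    (hsymm : ∀ x y, B x y = B y x) (hB : ∀ x, (∀ y, B x y = 0) → x = 0)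
    (hJ : ∀ x, J (J x) = -x) (hskew : ∀ x y, B (J x) y = -B x (J y)) :
    ∃ (k : ℕ) (e : Fin k → V) (ε : Fin k → ℝ), IsPseudoUnitaryFamily B J e ε ∧
      Function.Surjective (complexCombination J e) := by
  by_contra! hcon
  have hall : ∀ k : ℕ, ∃ (e : Fin k → V) (ε : Fin k → ℝ), IsPseudoUnitaryFamily B J e ε := by
    intro k
    induction k with
    | zero => exact ⟨Fin.elim0, Fin.elim0, fun i => i.elim0, fun i => i.elim0, fun i => i.elim0⟩
    | succ k ih =>
      obtain ⟨e, ε, he⟩ := ih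
      obtain ⟨v, hv, hvo⟩ :=
        he.exists_orthogonal_of_not_surjective hsymm hB hJ hskew (hcon k e ε he)
      exact ⟨_, _, he.cons hsymm hskew hv hvo⟩
  -- Unitary families of every length would exist, but one of length `k` embeds a real space of
  -- dimension `2k` in `V`.
  obtain ⟨e, ε, he⟩ := hall (Module.finrank ℝ V + 1)
  have h := LinearMap.finrank_le_finrank_of_injective (he.complexCombination_injective hJ hskew)
  rw [Module.finrank_pi_fintype] at h
  simp only [finrank_real_complex, Finset.sum_const, Finset.card_univ, Fintype.card_fin,
    smul_eq_mul] at h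
  omega

end HermitianNormalForm

/-! ### The standard forms and their signatures. -/

section PseudoInner

/-- The form `pseudoInner` as a bilinear form. -/
def pseudoInnerForm (p q : ℕ) : LinearMap.BilinForm ℝ (RSpace p q) :=
  LinearMap.mk₂ ℝ (pseudoInner p q)
    (fun x y z => by simp only [pseudoInner, Pi.add_apply, add_mul, Finset.sum_add_distrib]; ring)
    (fun c x y => by
      simp only [pseudoInner, Pi.smul_apply, smul_eq_mul, mul_assoc, ← Finset.mul_sum]; ring)
    (fun x y z => by simp only [pseudoInner, Pi.add_apply, mul_add, Finset.sum_add_distrib]; ring)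
    (fun c x y => by
      simp only [pseudoInner, Pi.smul_apply, smul_eq_mul, mul_left_comm _ c, ← Finset.mul_sum]
      ring)

theorem pseudoInnerForm_apply {p q : ℕ} (x y : RSpace p q) :
    pseudoInnerForm p q x y = pseudoInner p q x y := rfl

theorem pseudoInnerForm_symm {p q : ℕ} (x y : RSpace p q) :
    pseudoInnerForm p q x y = pseudoInnerForm p q y x := by
  simp only [pseudoInnerForm_apply, pseudoInner, mul_comm]

theorem eq_zero_of_forall_pseudoInnerForm_eq_zero {p q : ℕ} (x : RSpace p q)
    (h : ∀ y, pseudoInnerForm p q x y = 0) : x = 0 := by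
  ext i
  have hi := h (Pi.single i 1)
  rcases i with i | i <;>
  simpa [pseudoInnerForm_apply, pseudoInner, Pi.single_apply] using hi

theorem pseudoInnerForm_nondegenerate (p q : ℕ) : (pseudoInnerForm p q).Nondegenerate :=
  ⟨eq_zero_of_forall_pseudoInnerForm_eq_zero, fun x h =>
    eq_zero_of_forall_pseudoInnerForm_eq_zero x fun y => by rw [pseudoInnerForm_symm, h]⟩

theorem pseudoHermitian_re {r s : ℕ} (z w : CSpace r s) :
    (pseudoHermitian r s z w).re = ∑ i, (star (z (Sum.inl i)) * w (Sum.inl i)).re -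
      ∑ j, (star (z (Sum.inr j)) * w (Sum.inr j)).re := by
  rw [pseudoHermitian, Complex.sub_re, Complex.re_sum, Complex.re_sum]

/-- The real part determines the Hermitian form, so a complex linear map preserving the real part is
unitary. -/
theorem pseudoHermitian_im {r s : ℕ} (z w : CSpace r s) :
    (pseudoHermitian r s z w).im = -(pseudoHermitian r s z (Complex.I • w)).re := by
  have h : pseudoHermitian r s z (Complex.I • w) = Complex.I * pseudoHermitian r s z w := by
    simp only [pseudoHermitian, Pi.smul_apply, smul_eq_mul, mul_sub, Finset.mul_sum,
      mul_left_comm _ Complex.I]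
  rw [h, Complex.I_mul_re, neg_neg]

theorem exists_equiv_sum_of_sign {k : ℕ} {ε : Fin k → ℝ} (hε : ∀ i, ε i = 1 ∨ ε i = -1) :
    ∃ (r s : ℕ) (σ : Fin r ⊕ Fin s ≃ Fin k),
      (∀ i, ε (σ (Sum.inl i)) = 1) ∧ ∀ j, ε (σ (Sum.inr j)) = -1 := by
  classical
  refine ⟨_, _, (Equiv.sumCongr (Fintype.equivFin {i // ε i = 1}).symm
    (Fintype.equivFin {i // ¬ ε i = 1}).symm).trans (Equiv.sumCompl fun i => ε i = 1), ?_, ?_⟩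
  · intro i
    exact ((Fintype.equivFin {i // ε i = 1}).symm i).2
  · intro j
    exact (hε _).resolve_left ((Fintype.equivFin {i // ¬ ε i = 1}).symm j).2

/-- An orthogonal complex structure on `ℝ^{p,q}` identifies this space with some `ℂ^{r,s}`. -/
theorem exists_linearEquiv_of_complexStructure {p q : ℕ} {J : RSpace p q →ₗ[ℝ] RSpace p q}
    (hJ : ∀ x, J (J x) = -x)
    (hskew : ∀ x y, pseudoInnerForm p q (J x) y = -pseudoInnerForm p q x (J y)) :
    ∃ (r s : ℕ) (φ : CSpace r s ≃ₗ[ℝ] RSpace p q),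
      (∀ z w, pseudoInner p q (φ z) (φ w) = (pseudoHermitian r s z w).re) ∧
      ∀ z, φ (Complex.I • z) = J (φ z) := by
  obtain ⟨k, e, ε, he, hsurj⟩ := exists_isPseudoUnitaryFamily_surjective
    pseudoInnerForm_symm eq_zero_of_forall_pseudoInnerForm_eq_zero hJ hskew
  obtain ⟨r, s, σ, hσ, hσ'⟩ := exists_equiv_sum_of_sign he.sign
  let ψ : (Fin k → ℂ) ≃ₗ[ℝ] RSpace p q := LinearEquiv.ofBijective (complexCombination J e)
    ⟨he.complexCombination_injective hJ hskew, hsurj⟩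
  refine ⟨r, s, (LinearEquiv.funCongrLeft ℝ ℂ σ.symm).trans ψ, fun z w => ?_, fun z => ?_⟩
  · have h := he.complexCombination_apply_apply hJ hskew (z ∘ σ.symm) (w ∘ σ.symm)
    refine h.trans ?_
    rw [← Equiv.sum_comp σ, Fintype.sum_sum_type, pseudoHermitian_re, sub_eq_add_neg]
    simp only [hσ, hσ', Function.comp_apply, Equiv.symm_apply_apply, one_mul, neg_one_mul,
      Finset.sum_neg_distrib]
  · exact complexCombination_I_smul hJ e (z ∘ σ.symm)

/-- Sylvester's law of inertia for the real part of a Hermitian form. -/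
theorem eq_two_mul_of_pseudoInner_eq_re {p q r s : ℕ} (φ : CSpace r s ≃ₗ[ℝ] RSpace p q)
    (hφ : ∀ z w, pseudoInner p q (φ z) (φ w) = (pseudoHermitian r s z w).re) :
    p = 2 * r ∧ q = 2 * s := by
  have hdim := φ.finrank_eq
  have hsq : ∀ c : ℂ, (star c * c).re = c.re * c.re + c.im * c.im := fun c => by
    simp
  have hsum : ∀ {n : ℕ} (z : Fin n → ℂ), ∑ i, (star (z i) * z i).re ≤ 0 → z = 0 := by
    intro n z hz
    have h1 : ∀ i, 0 ≤ (star (z i) * z i).re := fun i => by rw [hsq]; nlinarith [sq_nonneg (z i).re, sq_nonneg (z i).im]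
    have h2 := (Finset.sum_eq_zero_iff_of_nonneg fun i _ => h1 i).1
      (le_antisymm hz (Finset.sum_nonneg fun i _ => h1 i))
    ext i
    have h3 := h2 i (Finset.mem_univ i)
    rw [hsq] at h3
    rw [Pi.zero_apply, ← Complex.normSq_eq_zero, Complex.normSq_apply, h3]
  have hpos : ∀ x : RSpace p q, (∀ i, x (Sum.inl i) = 0) → pseudoInner p q x x ≤ 0 := by
    intro x hx
    simp only [pseudoInner, hx, mul_zero, Finset.sum_const_zero, zero_sub, neg_nonpos]
    exact Finset.sum_nonneg fun i _ => mul_self_nonneg _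
  have hneg : ∀ x : RSpace p q, (∀ i, x (Sum.inr i) = 0) → 0 ≤ pseudoInner p q x x := by
    intro x hx
    simp only [pseudoInner, hx, mul_zero, Finset.sum_const_zero, sub_zero]
    exact Finset.sum_nonneg fun i _ => mul_self_nonneg _
  let incl : ((Fin r → ℂ) × (Fin s → ℂ)) ≃ₗ[ℝ] CSpace r s :=
    (LinearEquiv.sumArrowLequivProdArrow (Fin r) (Fin s) ℝ ℂ).symm
  -- The image of the positive definite `ℂ^r` meets the negative summand `ℝ^q` only in `0`, so it
  -- projects injectively to `ℝ^p` and `2r ≤ p`. Likewise `2s ≤ q`, and `2r + 2s = p + q` forces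
  -- equality.
  have hr := LinearMap.finrank_le_finrank_of_injective (f := LinearMap.funLeft ℝ ℝ Sum.inl ∘ₗ
      φ.toLinearMap ∘ₗ incl.toLinearMap ∘ₗ LinearMap.inl ℝ (Fin r → ℂ) (Fin s → ℂ)) (by
    rw [injective_iff_map_eq_zero]
    intro z hz
    have h := hpos (φ (incl (z, 0))) fun i => congrFun hz i
    rw [hφ, pseudoHermitian_re] at h
    exact hsum z (by simpa [incl] using h))
  have hs := LinearMap.finrank_le_finrank_of_injective (f := LinearMap.funLeft ℝ ℝ Sum.inr ∘ₗ
      φ.toLinearMap ∘ₗ incl.toLinearMap ∘ₗ LinearMap.inr ℝ (Fin r → ℂ) (Fin s → ℂ)) (by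
    rw [injective_iff_map_eq_zero]
    intro z hz
    have h := hneg (φ (incl (0, z))) fun i => congrFun hz i
    rw [hφ, pseudoHermitian_re] at h
    exact hsum z (by simpa [incl] using h))
  rw [Module.finrank_pi_fintype] at hdim hr hs
  simp only [Complex.finrank_real_complex, Finset.sum_const, Finset.card_univ, Fintype.card_fin,
    Fintype.card_sum, smul_eq_mul, Module.finrank_fintype_fun_eq_card] at hdim hr hs
  omega

end PseudoInner

/-! ### Central elements in terms of operators. -/

section FaithfulIrreducible

attribute [local instance] LieRing.ofAssociativeRing

/-- If the image of a Lie algebra under an injective representation is irreducible, and if the Lie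
algebra is not semisimple, then a nonzero element acts by an operator which commutes with the
image. -/
theorem exists_ne_zero_forall_commute_of_not_isSemisimple {K L V : Type*} [Field K] [CharZero K]
    [LieRing L] [LieAlgebra K L] [FiniteDimensional K L] [AddCommGroup V] [Module K V]
    [FiniteDimensional K V] [Nontrivial V] (ρ : L →ₗ[K] Module.End K V)
    (hlie : ∀ x y, ρ ⁅x, y⁆ = ρ x * ρ y - ρ y * ρ x) (hinj : Function.Injective ρ)
    (hirr : ∀ W : Submodule K V, (∀ x, ∀ v ∈ W, ρ x v ∈ W) → W = ⊥ ∨ W = ⊤)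
    (hss : ¬ LieAlgebra.IsSemisimple K L) : ∃ x, x ≠ 0 ∧ ∀ y, Commute (ρ x) (ρ y) := by
  let f : L →ₗ⁅K⁆ Module.End K V := { ρ with map_lie' := fun {x y} => hlie x y }
  let _ : LieRingModule L V := LieRingModule.compLieHom V f
  have hmod : LieModule K L V := LieModule.compLieHom V f
  have hirr' : LieModule.IsIrreducible K L V := by
    refine LieModule.IsIrreducible.mk fun N hN => ?_
    rcases hirr N.toSubmodule fun x v hv => N.lie_mem hv with h | h
    · exact absurd ((LieSubmodule.toSubmodule_eq_bot N).1 h) hN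
    · exact (LieSubmodule.toSubmodule_eq_top N).1 h
  have hfaith : LieModule.IsFaithful K L V := ⟨fun x y hxy => hinj hxy⟩
  obtain ⟨x, hx, hx0⟩ := exists_mem_center_ne_zero_of_not_isSemisimple (M := V) hss
  refine ⟨x, hx0, fun y => ?_⟩
  have h : ρ ⁅y, x⁆ = 0 := by rw [(LieModule.mem_maxTrivSubmodule K L L x).1 hx y, map_zero]
  rw [hlie, sub_eq_zero] at h
  exact h.symm

end FaithfulIrreducible

/-! ### The Lie algebra of an immersed subgroup as operators. -/

section ImmersedSubgroup

/-- The homomorphism from a Lie group to the algebra of endomorphisms of `ℝ^{p,q}` which is defined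
by a homomorphism to the general linear group. -/
def toEndHom {p q : ℕ} {H : Type*} [Group H] (ι : H →* RGL p q) :
    H →* (RSpace p q →L[ℝ] RSpace p q) :=
  (Units.coeHom _).comp ι

variable {p q d : ℕ} {G : Subgroup (RGL p q)} {H : Type*} [Group H] [TopologicalSpace H]
  [ChartedSpace (EuclideanSpace ℝ (Fin d)) H] {ι : H →* RGL p q}

/-- The inclusion of the units is itself the chart of `Aˣ`, so its derivative is the identity. -/
theorem mfderiv_units_val_injective {A : Type*} [NormedRing A] [NormedAlgebra ℝ A]
    [CompleteSpace A] (u : Aˣ) :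
    Function.Injective (mfderiv 𝓘(ℝ, A) 𝓘(ℝ, A) (Units.val : Aˣ → A) u) := by
  have h : mfderiv 𝓘(ℝ, A) 𝓘(ℝ, A) (extChartAt 𝓘(ℝ, A) u) u = ContinuousLinearMap.id ℝ _ :=
    mfderiv_extChartAt_self
  intro v w hvw
  have h1 : ∀ v, mfderiv 𝓘(ℝ, A) 𝓘(ℝ, A) (Units.val : Aˣ → A) u v = v :=
    fun v => DFunLike.congr_fun h v
  rwa [h1, h1] at hvw

theorem IsImmersedLieSubgroup.contMDiff_toEndHom (hG : IsImmersedLieSubgroup d G ι) :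
    ContMDiff (𝓡 d) 𝓘(ℝ, RSpace p q →L[ℝ] RSpace p q) ∞ (toEndHom ι) :=
  Units.contMDiff_val.comp hG.contMDiff

theorem IsImmersedLieSubgroup.tangentMapOne_injective (hG : IsImmersedLieSubgroup d G ι) :
    Function.Injective (tangentMapOne (toEndHom ι) :
      GroupLieAlgebra (𝓡 d) H → RSpace p q →L[ℝ] RSpace p q) := by
  have h : mfderiv (𝓡 d) 𝓘(ℝ, RSpace p q →L[ℝ] RSpace p q)
      ((Units.val : RGL p q → RSpace p q →L[ℝ] RSpace p q) ∘ ι) 1 = _ :=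
    mfderiv_comp (I' := 𝓘(ℝ, RSpace p q →L[ℝ] RSpace p q)) (1 : H)
      ((Units.contMDiff_val (n := ∞) (ι 1)).mdifferentiableAt (by simp))
      ((hG.contMDiff 1).mdifferentiableAt (by simp))
  intro v w hvw
  refine hG.injective_mfderiv 1 (mfderiv_units_val_injective (ι 1) ?_)
  exact (DFunLike.congr_fun h v).symm.trans (Eq.trans hvw (DFunLike.congr_fun h w))

end ImmersedSubgroup

/-! ### Irreducible operator groups and one-parameter groups. -/

section Subgroups

variable {p q : ℕ} {G : Subgroup (RGL p q)}

/-- The underlying set of operators of a subgroup of the general linear group. -/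
def operatorSet (G : Subgroup (RGL p q)) : Set (RSpace p q →L[ℝ] RSpace p q) :=
  Units.val '' (G : Set (RGL p q))

theorem isIrreducibleSet_operatorSet (h : (tautologicalRep G).IsIrreducible) :
    IsIrreducibleSet (operatorSet G) := by
  intro W hW
  let S : Subrepresentation (tautologicalRep G) :=
    ⟨W, fun g v hv => hW _ ⟨(g : RGL p q), g.2, rfl⟩ v hv⟩
  rcases h.eq_bot_or_eq_top S with hS | hS
  · exact Or.inl (congrArg Subrepresentation.toSubmodule hS)
  · exact Or.inr (congrArg Subrepresentation.toSubmodule hS)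

theorem nontrivial_of_isIrreducible_tautologicalRep (h : (tautologicalRep G).IsIrreducible) :
    Nontrivial (RSpace p q) := by
  by_contra hn
  rw [not_nontrivial_iff_subsingleton] at hn
  obtain ⟨S, T, hST⟩ := h.toNontrivial
  refine hST (Subrepresentation.toSubmodule_injective (Subsingleton.elim _ _))

/-- The one-parameter groups of `O(p,q)` are generated by skew-symmetric operators. -/
theorem pseudoInnerForm_skew_of_exp_mem {X : RSpace p q →L[ℝ] RSpace p q}
    (hX : ∀ t : ℝ, NormedSpace.exp (t • X) ∈ operatorSet (pseudoOrthogonalGroup p q))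
    (x y : RSpace p q) : pseudoInnerForm p q (X x) y = -pseudoInnerForm p q x (X y) := by
  let B : RSpace p q →L[ℝ] RSpace p q →L[ℝ] ℝ := LinearMap.toContinuousLinearMap
    (LinearMap.toContinuousLinearMap.toLinearMap ∘ₗ pseudoInnerForm p q)
  have hexp : HasDerivAt (fun t : ℝ => NormedSpace.exp (t • X)) X 0 := by
    simpa using hasDerivAt_exp_smul_const' X (0 : ℝ)
  have happ : ∀ v, HasDerivAt (fun t : ℝ => NormedSpace.exp (t • X) v) (X v) 0 := fun v => by
    simpa using hexp.clm_apply (hasDerivAt_const (0 : ℝ) v)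
  have hd := (B.hasFDerivAt.comp_hasDerivAt (0 : ℝ) (happ x)).clm_apply (happ y)
  -- The form is constant along `(exp (tX) x, exp (tX) y)`; skewness is the vanishing of the
  -- derivative at `t = 0`.
  have hconst : (fun t : ℝ => (B ∘ fun t : ℝ => NormedSpace.exp (t • X) x) t
      (NormedSpace.exp (t • X) y)) = fun _ => pseudoInnerForm p q x y := by
    ext t
    obtain ⟨g, hg, hgt⟩ := hX t
    rw [Function.comp_apply, ← hgt]
    exact hg x y
  rw [hconst] at hd
  have h := hd.unique (hasDerivAt_const (0 : ℝ) (pseudoInnerForm p q x y))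
  simp only [Function.comp_apply, zero_smul, NormedSpace.exp_zero, one_apply_eq_self] at h
  exact eq_neg_of_add_eq_zero_left h

open NormedSpace Complex in
-- The continuous algebra homomorphism `ℂ → A` with `I ↦ J` commutes with exponentials; apply it to
-- `exp (θ I)`.
theorem exp_smul_eq_of_mul_self_eq_neg_one {A : Type*} [NormedRing A] [NormedAlgebra ℝ A]
    [CompleteSpace A] {J : A} (hJ : J * J = -1) (θ : ℝ) :
    exp (θ • J) = (Circle.exp θ : ℂ).re • (1 : A) + (Circle.exp θ : ℂ).im • J := by
  let _ : NormedAlgebra ℚ A := NormedAlgebra.restrictScalars ℚ ℝ A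
  let f : ℂ →ₐ[ℝ] A := Complex.lift ⟨J, hJ⟩
  have hf : ∀ z : ℂ, f z = z.re • (1 : A) + z.im • J := fun z => by
    rw [← Algebra.algebraMap_eq_smul_one]
    exact Complex.liftAux_apply J hJ z
  have hcont : Continuous f := f.toLinearMap.continuous_of_finiteDimensional
  have h := map_exp f hcont (θ * I)
  rw [hf (θ * I)] at h
  simp only [mul_I_re, ofReal_im, neg_zero, zero_smul, zero_add, mul_I_im, ofReal_re] at h
  rw [← h, ← Complex.exp_eq_exp_ℂ, ← Circle.coe_exp, hf]

end Subgroups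

/-! ### The complex structure, unitarity and the center. -/

section ComplexStructure

variable {p q : ℕ} {G : Subgroup (RGL p q)}

/-- A connected Lie group of operators which is irreducible, but not semisimple, contains the circle
group of a complex structure which commutes with it. -/
theorem IsImmersedLieSubgroup.exists_complexStructure {d : ℕ} {H : Type*} [Group H]
    [TopologicalSpace H] [ChartedSpace (EuclideanSpace ℝ (Fin d)) H] [LieGroup (𝓡 d) ∞ H]
    [ConnectedSpace H] {ι : H →* RGL p q} (hG : IsImmersedLieSubgroup d G ι)
    (hO : G ≤ pseudoOrthogonalGroup p q) (hirr : (tautologicalRep G).IsIrreducible)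
    (hss : ¬ LieAlgebra.IsSemisimple ℝ (GroupLieAlgebra (𝓡 d) H)) :
    ∃ J : RSpace p q →L[ℝ] RSpace p q, J * J = -1 ∧
      J ∈ Subalgebra.centralizer ℝ (operatorSet G) ∧
      (∀ x y, pseudoInnerForm p q (J x) y = -pseudoInnerForm p q x (J y)) ∧
      ∀ θ : ℝ, NormedSpace.exp (θ • J) ∈ operatorSet G := by
  have hF := hG.contMDiff_toEndHom
  have hnontriv := nontrivial_of_isIrreducible_tautologicalRep hirr
  have hfin : FiniteDimensional ℝ (GroupLieAlgebra (𝓡 d) H) :=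
    inferInstanceAs (FiniteDimensional ℝ (EuclideanSpace ℝ (Fin d)))
  have hmem : ∀ g ∈ operatorSet G, ∃ h, toEndHom ι h = g := by
    rintro _ ⟨g, hg, rfl⟩
    rw [← hG.range_eq] at hg
    obtain ⟨h, rfl⟩ := hg
    exact ⟨h, rfl⟩
  have hmem' : ∀ h, toEndHom ι h ∈ operatorSet G := fun h =>
    ⟨ι h, hG.range_eq ▸ ⟨h, rfl⟩, rfl⟩
  let ρ : GroupLieAlgebra (𝓡 d) H →ₗ[ℝ] RSpace p q →L[ℝ] RSpace p q := tangentMapOne (toEndHom ι)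
  have hadj : ∀ g ∈ operatorSet G, g ∈ Algebra.adjoin ℝ (Set.range ρ) := by
    intro g hg
    obtain ⟨h, rfl⟩ := hmem g hg
    exact mem_adjoin_range_tangentMapOne hF h
  -- A subspace stable under the Lie algebra is stable under the algebra it generates, which
  -- contains `G`.
  have hirrρ : ∀ W : Submodule ℝ (RSpace p q), (∀ v, ∀ x ∈ W, ρ v x ∈ W) → W = ⊥ ∨ W = ⊤ := by
    intro W hW
    refine isIrreducibleSet_operatorSet hirr W fun g hg => ?_
    have hgadj := hadj g hg
    clear hg
    induction hgadj using Algebra.adjoin_induction with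
    | mem T hT =>
      obtain ⟨v, rfl⟩ := hT
      exact hW v
    | algebraMap r => exact fun x hx => W.smul_mem r hx
    | add S T _ _ hS hT => exact fun x hx => W.add_mem (hS x hx) (hT x hx)
    | mul S T _ _ hS hT => exact fun x hx => hS _ (hT x hx)
  obtain ⟨v, hv0, hv⟩ := exists_ne_zero_forall_commute_of_not_isSemisimple
    (ContinuousLinearMap.coeLM ℝ ∘ₗ ρ)
    (fun v w => congrArg ContinuousLinearMap.toLinearMap (tangentMapOne_lie hF v w))
    (ContinuousLinearMap.coe_injective.comp hG.tangentMapOne_injective) hirrρ hss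
  have hcentral : ρ v ∈ Subalgebra.centralizer ℝ (operatorSet G) := by
    rw [Subalgebra.mem_centralizer_iff]
    intro g hg
    have hle : Algebra.adjoin ℝ (Set.range ρ) ≤ Subalgebra.centralizer ℝ {ρ v} := by
      refine Algebra.adjoin_le ?_
      rintro _ ⟨w, rfl⟩
      rw [SetLike.mem_coe, Subalgebra.mem_centralizer_iff]
      rintro _ rfl
      exact ContinuousLinearMap.coe_injective (hv w)
    exact ((Subalgebra.mem_centralizer_iff ℝ).1 (hle (hadj g hg)) _ rfl).symm
  have hexp : ∀ t : ℝ, NormedSpace.exp (t • ρ v) ∈ operatorSet G := by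
    intro t
    obtain ⟨h, hh⟩ := exp_smul_tangentMapOne_mem_range hF v t
    exact hh ▸ hmem' h
  have hskew := pseudoInnerForm_skew_of_exp_mem fun t => Set.image_mono hO (hexp t)
  have hρv0 : ρ v ≠ 0 := fun h => hv0 (hG.tangentMapOne_injective (h.trans (map_zero ρ).symm))
  obtain ⟨c, -, hc⟩ := (isIrreducibleSet_operatorSet hirr).exists_mul_self_eq_neg_one
    (pseudoInnerForm_nondegenerate p q) hcentral hρv0 hskew
  refine ⟨c • ρ v, hc, Subalgebra.smul_mem _ hcentral c, fun x y => ?_, fun θ => ?_⟩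
  · rw [smul_apply, smul_apply, map_smul, map_smul,
      LinearMap.smul_apply, hskew, smul_neg]
  · rw [smul_smul]
    exact hexp _

theorem realify_apply {r s : ℕ} (φ : CSpace r s ≃ₗ[ℝ] RSpace p q)
    (A : CSpace r s ≃ₗ[ℂ] CSpace r s) (x : RSpace p q) :
    (realify φ A).val x = φ (A (φ.symm x)) := rfl

/-- Operators which commute with a complex structure are complex linear. -/
theorem exists_realify_eq_of_commute {r s : ℕ} {φ : CSpace r s ≃ₗ[ℝ] RSpace p q}
    {J : RSpace p q →L[ℝ] RSpace p q} (hφJ : ∀ z, φ (Complex.I • z) = J (φ z)) {g : RGL p q}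
    (hg : ∀ x, g.val (J x) = J (g.val x)) : ∃ A, realify φ A = g := by
  let g' : RSpace p q ≃L[ℝ] RSpace p q := ContinuousLinearEquiv.unitsEquiv ℝ _ g
  let A : CSpace r s ≃ₗ[ℝ] CSpace r s := (φ.trans g'.toLinearEquiv).trans φ.symm
  have hA : ∀ z, φ (A z) = g.val (φ z) := fun z => φ.apply_symm_apply _
  have hAI : ∀ z, A (Complex.I • z) = Complex.I • A z := fun z => by
    apply φ.injective
    rw [hA, hφJ, hφJ, hg, hA]
  have hsmul : ∀ (c : ℂ) (z : CSpace r s), c • z = c.re • z + c.im • (Complex.I • z) := by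
    intro c z
    conv_lhs => rw [← Complex.re_add_im c, add_smul, mul_smul, Complex.coe_smul, Complex.coe_smul]
  refine ⟨{ A with map_smul' := fun c z => ?_ }, ?_⟩
  · change A (c • z) = c • A z
    rw [hsmul, hsmul c, map_add, map_smul, map_smul, hAI]
  · ext1
    ext1 x
    rw [realify_apply]
    exact (hA _).trans (by rw [φ.apply_symm_apply])

theorem exists_mem_pseudoUnitaryGroup_realify_eq {r s : ℕ} {φ : CSpace r s ≃ₗ[ℝ] RSpace p q}
    (hφ : ∀ z w, pseudoInner p q (φ z) (φ w) = (pseudoHermitian r s z w).re)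
    {J : RSpace p q →L[ℝ] RSpace p q} (hφJ : ∀ z, φ (Complex.I • z) = J (φ z)) {g : RGL p q}
    (hgO : g ∈ pseudoOrthogonalGroup p q) (hg : ∀ x, g.val (J x) = J (g.val x)) :
    g ∈ (pseudoUnitaryGroup r s).map (realify φ) := by
  obtain ⟨A, rfl⟩ := exists_realify_eq_of_commute hφJ hg
  refine ⟨A, fun z w => ?_, rfl⟩
  have hre : ∀ z w, (pseudoHermitian r s (A z) (A w)).re = (pseudoHermitian r s z w).re := by
    intro z w
    have h := hgO (φ z) (φ w)
    rwa [realify_apply, realify_apply, φ.symm_apply_apply, φ.symm_apply_apply, hφ, hφ] at h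
  apply Complex.ext
  · exact hre z w
  · rw [pseudoHermitian_im, pseudoHermitian_im, ← map_smul, hre]

/-- The center of an irreducible group of orthogonal operators which contains the circle group of a
complex structure, and which commutes with it, is this circle group. -/
theorem map_subtype_center_eq_map_scalarCircle (hO : G ≤ pseudoOrthogonalGroup p q)
    (hirr : (tautologicalRep G).IsIrreducible) {J : RSpace p q →L[ℝ] RSpace p q}
    (hJ : J * J = -1) (hJG : J ∈ Subalgebra.centralizer ℝ (operatorSet G))
    (hskew : ∀ x y, pseudoInnerForm p q (J x) y = -pseudoInnerForm p q x (J y))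
    (hexp : ∀ θ : ℝ, NormedSpace.exp (θ • J) ∈ operatorSet G) {r s : ℕ}
    {φ : CSpace r s ≃ₗ[ℝ] RSpace p q} (hφJ : ∀ z, φ (Complex.I • z) = J (φ z)) :
    (Subgroup.center G).map G.subtype = (scalarCircle r s).map (realify φ) := by
  have hcircle : ∀ (c : Circle) (x : RSpace p q),
      (realify φ (DistribMulAction.toModuleAut ℂ (CSpace r s) c)).val x =
        (c : ℂ).re • x + (c : ℂ).im • J x := by
    intro c x
    rw [realify_apply]
    change φ ((c : ℂ) • φ.symm x) = _
    conv_lhs => rw [← Complex.re_add_im c, add_smul, mul_smul, Complex.coe_smul, Complex.coe_smul]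
    rw [map_add, map_smul, map_smul, hφJ, φ.apply_symm_apply]
  have hJG' := (Subalgebra.mem_centralizer_iff ℝ).1 hJG
  apply le_antisymm
  · rintro _ ⟨g, hg, rfl⟩
    have hnontriv := nontrivial_of_isIrreducible_tautologicalRep hirr
    have hdom := (isIrreducibleSet_operatorSet hirr).isDomain_centralizer
    have hgG : (g : RGL p q).val ∈ Subalgebra.centralizer ℝ (operatorSet G) := by
      rw [Subalgebra.mem_centralizer_iff]
      rintro _ ⟨k, hk, rfl⟩
      have h := Subgroup.mem_center_iff.1 hg ⟨k, hk⟩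
      exact congrArg (fun u : G => (u : RGL p q).val) h
    -- The commutant of `G` may be larger than `ℝ + ℝJ`, but `g` also commutes with `J`, because `g
    -- ∈ G`.
    obtain ⟨a, b, hab⟩ := exists_eq_smul_one_add_smul_of_commute
      (J := (⟨J, hJG⟩ : Subalgebra.centralizer ℝ (operatorSet G)))
      (T := ⟨_, hgG⟩) (Subtype.ext hJ) (Subtype.ext (hJG' _ ⟨_, g.2, rfl⟩))
    have hab' : ∀ x, (g : RGL p q).val x = a • x + b • J x :=
      fun x => DFunLike.congr_fun (congrArg Subtype.val hab) x
    have hJJ : ∀ x, J (J x) = -x := fun x => DFunLike.congr_fun hJ x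
    -- By skewness the cross terms cancel and `J` preserves the form, so `a + bJ` multiplies the
    -- form by `a² + b²`.
    have hnorm : a * a + b * b = 1 := by
      obtain ⟨x, hx⟩ := exists_ne (0 : RSpace p q)
      obtain ⟨y, hy⟩ : ∃ y, pseudoInnerForm p q x y ≠ 0 := by
        by_contra! h
        exact hx (eq_zero_of_forall_pseudoInnerForm_eq_zero x h)
      have h : pseudoInnerForm p q ((g : RGL p q).val x) ((g : RGL p q).val y) =
        pseudoInnerForm p q x y := hO g.2 x y
      rw [hab', hab'] at h
      simp only [map_add, map_smul, LinearMap.add_apply, LinearMap.smul_apply, smul_eq_mul, hskew,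
        hJJ, map_neg] at h
      refine mul_right_cancel₀ hy ?_
      linear_combination h
    let c : Circle := ⟨⟨a, b⟩, mem_sphere_zero_iff_norm.2 (by
      rw [Complex.norm_def, Complex.normSq_mk, hnorm, Real.sqrt_one])⟩
    refine ⟨_, ⟨c, rfl⟩, ?_⟩
    ext1
    ext1 x
    exact (hcircle c x).trans (hab' x).symm
  · rintro _ ⟨_, ⟨c, rfl⟩, rfl⟩
    obtain ⟨θ, rfl⟩ := Circle.exp_surjective c
    obtain ⟨g, hg, hgexp⟩ := hexp θ
    have hgeq : g = realify φ (DistribMulAction.toModuleAut ℂ (CSpace r s) (Circle.exp θ)) := by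
      ext1
      ext1 x
      rw [hcircle, hgexp, exp_smul_eq_of_mul_self_eq_neg_one hJ]
      rfl
    refine ⟨⟨g, hg⟩, Subgroup.mem_center_iff.2 fun k => Subtype.ext (Units.ext ?_), hgeq⟩
    have hk := hJG' _ ⟨(k : RGL p q), k.2, rfl⟩
    change (k : RGL p q).val * g.val = g.val * (k : RGL p q).val
    rw [hgexp, exp_smul_eq_of_mul_self_eq_neg_one hJ, mul_add, add_mul, mul_smul_comm,
      mul_smul_comm, smul_mul_assoc, smul_mul_assoc, hk, mul_one, one_mul]

end ComplexStructure

theorem corollary2 (p q : ℕ) (G : Subgroup (RGL p q))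
    {d : ℕ} {H : Type*} [Group H] [TopologicalSpace H]
    [ChartedSpace (EuclideanSpace ℝ (Fin d)) H] [LieGroup (𝓡 d) ∞ H] [ConnectedSpace H]
    (ι : H →* RGL p q) (hG : IsImmersedLieSubgroup d G ι)
    (hO : G ≤ pseudoOrthogonalGroup p q)
    (hirr : (tautologicalRep G).IsIrreducible)
    (hss : ¬ LieAlgebra.IsSemisimple ℝ (GroupLieAlgebra (𝓡 d) H)) :
    Even p ∧ Even q ∧
      ∃ φ : CSpace (p / 2) (q / 2) ≃ₗ[ℝ] RSpace p q,
        (∀ z w, pseudoInner p q (φ z) (φ w) = (pseudoHermitian (p / 2) (q / 2) z w).re) ∧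
        G ≤ (pseudoUnitaryGroup (p / 2) (q / 2)).map (realify φ) ∧
        (Subgroup.center G).map G.subtype = (scalarCircle (p / 2) (q / 2)).map (realify φ) := by
  obtain ⟨J, hJ, hJG, hskew, hexp⟩ := hG.exists_complexStructure hO hirr hss
  obtain ⟨r, s, φ, hφ, hφJ⟩ := exists_linearEquiv_of_complexStructure (J := J.toLinearMap)
    (fun x => DFunLike.congr_fun hJ x) hskew
  obtain ⟨hp, hq⟩ := eq_two_mul_of_pseudoInner_eq_re φ hφ
  obtain rfl : r = p / 2 := by omega
  obtain rfl : s = q / 2 := by omega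
  refine ⟨even_iff_two_dvd.2 ⟨_, hp⟩, even_iff_two_dvd.2 ⟨_, hq⟩, φ, hφ, fun g hg => ?_,
    map_subtype_center_eq_map_scalarCircle hO hirr hJ hJG hskew hexp hφJ⟩
  exact exists_mem_pseudoUnitaryGroup_realify_eq hφ hφJ (hO hg) fun x =>
    DFunLike.congr_fun ((Subalgebra.mem_centralizer_iff ℝ).1 hJG _ ⟨g, hg, rfl⟩) x
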